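/- **Circuit locality implies local simulation.** *Stabilizer games.* Let $d\ge 1$, $\omega=e^{2\pi i/d}$, and for $q\in(\mathbb Z_d^2)^k$ let $\sigma_q=\bigotimes_i X^{q_{i,0}}Z^{q_{i,1}}$. For $q,r\in(\mathbb Z_d^2)^k$ let $\mathrm{cor}_r(q)\in\mathbb Z_d$ be defined by $\omega^{\mathrm{cor}_r(q)}=\sigma_q\sigma_r\sigma_q^{-1}\sigma_r^{-1}$. An $(\ell,k,m)$ stabilizer game $\mathfrak G$ has $\ell$ players; a question $x_j$ to player $j$ is an $m_j$-tuple of labels of $k_j$-qudit Pauli operators from a set $X_j$ (commuting, for queries in the support of the query distribution $\pi$), an answer is $a_j\in\mathbb Z_d^{m_j}$, and the players win on a query $x$ if $w_x\cdot a=b_x$. We assume that $\mathfrak G$ has a perfect honest strategy: a pure state $\psi$ on which measuring the Pauli observables named by the questions (multiplied by phases that make them observables over $\mathbb Z_d$) wins on every query in the support of $\pi$ with certainty. In the rotated stretched game $\mathfrak G^{S,R}_\Gamma$ player $j$ has a larger set of qudits, of which $k_j$ are designated; Paulis are extended by the identity from the designated qudits, player $j$ answers with $a_j$ and a rotation string $r_j$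 (a Pauli label on all its qudits), and the win condition is $w_x\cdot(a-\mathrm{cor}_r(x))=b_x$. *Patterns.* The grid is $\mathbb Z_N\times\mathbb Z_N$. A star consists of a central box, $\ell$ further boxes (all disjoint, boxes being $L_\infty$-balls) and $\ell$ vertex-disjoint paths from the boundary of the central box to the boundaries of the other boxes that avoid all boxes in between. An input pattern is $P=\{(u^{(i)},\Gamma^{(i)})\}_{1\le i\le r}$, $1\le r\le N$, with $\Gamma^{(i)}$ a star and $u^{(i)}_j$ a vertex of its $j$-th noncentral box. Random patterns are sampled as follows: fix $r$ disjoint squares of side $M\le\lfloor N/\sqrt r\rfloor$ with $3L\sqrt{\ell+1}\le M$, $1\le\ell\le L$, in each square $T$ disjoint boxes of radius $L$, $\ell+1\le T\le\lfloor M/(2L+1)\rfloor^2$, and for each choice of $\ell+1$ distinct boxes in a square $\lfloor L/\ell\rfloor$ stars on them, contained in the square, of total path length at most $2\ell M$, the paths of different stars being vertex-disjoint; in each square choose uniformly and independently $\ell+1$ distinct boxes, the locations in the noncentral ones, and a star. For each pattern the paths are extended inside the boxes to vertex-disjoint routes, the $j$-th one from a vertex $g^{(i)}_j$ of the central box to $u^{(i)}_j$.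 *Circuit game $G_{\mathfrak G,N,r}$.* An input is a random pattern together with $r$ independent queries $x^{(1)},\dots,x^{(r)}\sim\pi$, encoded as a string in $\Sigma^{\mathrm{grid}}$, $\Sigma$ a finite alphabet: the vertex $u^{(i)}_j$ carries $x^{(i)}_j$, and the vertices of the routes carry the teleportation instructions. The ideal circuit places $4k$ qudits at each vertex ($k=\max_jk_j$; a group of $k$ facing each neighbour), prepares maximally entangled states between facing groups of neighbours and a copy of $\psi$ (padded) on $g^{(i)}_1,\dots,g^{(i)}_\ell$ for each $i$, performs Bell measurements along the routes, with outcomes labelled by $(a,b)\in\mathbb Z_d^2$ for the Bell state $(Z^b\otimes X^a)\frac1{\sqrt d}\sum_i|ii\rangle$, and performs the honest measurement of $x^{(i)}_j$ at $u^{(i)}_j$; outcomes are output at the vertex where they are obtained. A circuit wins on an input if the symbols it outputs along the routes are in the support of the output distribution of the ideal circuit on that input. *Circuits.* Let $\mathcal C$ be a (classical or quantum) layered circuit of depth $D$ with gates of fan-in at most $K$ and arbitrary fan-out, with inputs and outputs in $\Sigma^{\mathrm{grid}}$; gates may be arbitrary quantum channels. Let $L_f(u)$ be the set of output vertices that can be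 reached from the input vertex $u$ in the circuit graph, and $L_b(v)$ the set of input vertices from which $v$ can be reached. Let $\mathrm{BAD}_{in}$ be any set of vertices, and $\mathrm{Spec}=(L_f,\mathrm{BAD}_{in},\emptyset)$. A pair $(u^{(i)},\Gamma^{(i)})$ is *valid* if no $u^{(i)}_j$ lies in $\mathrm{BAD}_{in}$. A pattern is *Spec-causal* if for each of its pairs $i$: $L_f(u^{(i)}_j)\cap\Gamma^{(i)}$ is contained in the box of $u^{(i)}_j$ for all $j$; $L_f(u^{(i')}_j)\cap\Gamma^{(i)}=\emptyset$ for all other pairs $i'$ of the pattern and all $j$; and the pair is valid. **Lemma.** Let $P$ be a pattern in the support of the input distribution of $G_{\mathfrak G,N,r}$, and let $p$ be the probability that $\mathcal C$ wins in $G_{\mathfrak G,N,r}$ conditioned on the input pattern being $P$. Let $\delta\in[0,1]$. Assume that at least a fraction $1-\delta$ of the $r$ pairs of $P$ are valid and that the subpattern of $P$ that consists of the valid pairs is Spec-causal (so this holds with all pairs valid if $P$ itself is Spec-causal). Let $V\subseteq\{1,\dots,r\}$ be the set of valid pairs. Then there are, for each $i$, a partition of the vertices of $\Gamma^{(i)}$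 into sets $\widetilde\Gamma^{(i)}_1,\dots,\widetilde\Gamma^{(i)}_\ell$, with $\widetilde\Gamma^{(i)}_j$ containing the $j$-th route, such that for $i\in V$ no vertex of $\widetilde\Gamma^{(i)}_j$ has in its backward lightcone an input location of a valid pair other than $u^{(i)}_j$, and an $(r\ell)$-player entangled strategy for the $r$-fold repeated rotated stretched game, in whose $i$-th instance player $j$ has $k$ qudits for each vertex of $\widetilde\Gamma^{(i)}_j$, the first $k_j$ qudits at $u^{(i)}_j$ being designated, such that: 1. with probability at least $p$ (over $x\sim\pi^r$ and the players' measurements) the strategy wins in at least $(1-\delta)r$ of the $r$ instances; 2. there are queries $\bar x^{(i)}$, $1\le i\le r$, in the support of $\pi$ such that for every tuple of queries $x^{(1)},\dots,x^{(r)}$ the joint distribution of the answers of all players of the instances $i\in V$ is exactly that of the decoded output of $\mathcal C$ on the input that encodes $P$ and the queries $x^{(i)}$ for $i\in V$ and $\bar x^{(i)}$ for $i\notin V$. In particular, if $P$ is Spec-causal, the strategy reproduces exactly the decoded output distribution of $\mathcal C$, on every choice of queries. Here the decoded answer of player $j$ of instance $i$ depends on the output symbols in $\widetilde\Gamma^{(i)}_j$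 only: $a_j$ is the answer output at $u^{(i)}_j$, and the rotation string consists of the teleportation outcomes at the vertices other than $u^{(i)}_j$ and, at $u^{(i)}_j$, of the total Pauli correction $(\sum a,-\sum b)$ along the $j$-th route. -/

import Mathlib

open scoped ComplexOrder Matrix

/-! ### Pauli operators and stabilizer games -/

/-- Labels of Pauli operators on a set `κ` of qudits of dimension `d`: one pair in `ℤ_d²` per qudit. -/
abbrev PauliLabel (d : ℕ) (κ : Type) : Type := κ → ZMod d × ZMod d

/-- `ω ^ a` for `a : ℤ_d`, where `ω = exp (2πi / d)`. -/
noncomputable def rootPow (d : ℕ) [NeZero d] (a : ZMod d) : ℂ := ZMod.stdAddChar a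

/-- The Pauli operator `σ_q = ⨂ᵢ X ^ (q i).1 * Z ^ (q i).2` on `(ℂ^d)^{⊗ κ}`; in the computational
basis `X^a Z^b |g⟩ = ω^(b g) |g + a⟩`. -/
noncomputable def pauli {d : ℕ} [NeZero d] {κ : Type} [Fintype κ] (q : PauliLabel d κ) :
    Matrix (κ → ZMod d) (κ → ZMod d) ℂ :=
  Matrix.of fun f g => ∏ i, if f i = g i + (q i).1 then rootPow d ((q i).2 * g i) else 0

/-- The correction value `cor_r(q)`; see `pauli_commutator` for its characterization
`ω ^ cor_r(q) = [σ_q, σ_r]`. -/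
def cor {d : ℕ} {κ : Type} [Fintype κ] (r q : PauliLabel d κ) : ZMod d :=
  ∑ i, ((q i).2 * (r i).1 - (q i).1 * (r i).2)

theorem pauli_apply {d : ℕ} [NeZero d] {κ : Type} [Fintype κ] [DecidableEq κ]
    (q : PauliLabel d κ) (f g : κ → ZMod d) :
    pauli q f g = if f = (fun i => g i + (q i).1) then rootPow d (∑ i, (q i).2 * g i) else 0 := by
  unfold pauli
  rw [Matrix.of_apply]
  by_cases h : f = fun i => g i + (q i).1
  · rw [if_pos h]
    subst h
    simp only [if_true]
    exact (map_prod (ZMod.stdAddChar (N := d)).toMonoidHom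
      (fun i => Multiplicative.ofAdd ((q i).2 * g i)) Finset.univ).symm
  · rw [if_neg h]
    obtain ⟨i, hi⟩ := Function.ne_iff.mp h
    exact Finset.prod_eq_zero (Finset.mem_univ i) (if_neg hi)

theorem pauli_mul_apply {d : ℕ} [NeZero d] {κ : Type} [Fintype κ] [DecidableEq κ]
    (q r : PauliLabel d κ) (f g : κ → ZMod d) :
    (pauli q * pauli r) f g =
      if f = (fun i => g i + (r i).1 + (q i).1) then
        rootPow d (∑ i, ((q i).2 * (g i + (r i).1) + (r i).2 * g i)) else 0 := by
  rw [Matrix.mul_apply, Finset.sum_eq_single (fun i => g i + (r i).1)]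
  · simp only [pauli_apply, if_true]
    split_ifs with h
    · simp [rootPow, Finset.sum_add_distrib, AddChar.map_add_eq_mul]
    · simp
  · intro b _ hb
    rw [pauli_apply r, if_neg hb, mul_zero]
  · simp

/-- `σ_q σ_r = ω ^ cor_r(q) σ_r σ_q`, i.e. `ω ^ cor_r(q)` is the group commutator of `σ_q`, `σ_r`. -/
theorem pauli_commutator {d : ℕ} [NeZero d] {κ : Type} [Fintype κ] [DecidableEq κ]
    (q r : PauliLabel d κ) :
    pauli q * pauli r = rootPow d (cor r q) • (pauli r * pauli q) := by
  ext f g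
  rw [Matrix.smul_apply, pauli_mul_apply, pauli_mul_apply]
  have h : (fun i => g i + (r i).1 + (q i).1) = fun i => g i + (q i).1 + (r i).1 := by
    funext i; ring
  rw [h]
  split_ifs with hf
  · rw [smul_eq_mul, rootPow, rootPow, rootPow, ← AddChar.map_add_eq_mul]
    congr 1
    rw [cor, ← Finset.sum_add_distrib]
    refine Finset.sum_congr rfl fun i _ => ?_
    ring
  · simp

/-- An `(ℓ, k, m)` stabilizer game over `ℤ_d`. The `k_j` qudits of player `j` are indexed by the
type `κ j`. A question to player `j` is an `m_j`-tuple of elements of the set `labels j` (`X_j`).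
The values of `w` and `b` matter only for queries in the support of `dist` (`π`). -/
structure StabilizerGame (ℓ d : ℕ) [NeZero d] (κ : Fin ℓ → Type) [∀ j, Fintype (κ j)]
    [∀ j, DecidableEq (κ j)] (m : Fin ℓ → ℕ) where
  labels : ∀ j, Finset (PauliLabel d (κ j))
  dist : PMF (∀ j, Fin (m j) → labels j)
  commuting : ∀ x ∈ dist.support, ∀ j s t,
    Commute (pauli (x j s : PauliLabel d (κ j))) (pauli (x j t : PauliLabel d (κ j)))
  w : (∀ j, Fin (m j) → labels j) → ∀ j, Fin (m j) → ZMod d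
  b : (∀ j, Fin (m j) → labels j) → ZMod d

namespace StabilizerGame

variable {ℓ d : ℕ} [NeZero d] {κ κ' : Fin ℓ → Type} [∀ j, Fintype (κ j)] [∀ j, DecidableEq (κ j)]
  [∀ j, Fintype (κ' j)] [∀ j, DecidableEq (κ' j)] {m : Fin ℓ → ℕ}

/-- Questions to player `j`. -/
abbrev Question (G : StabilizerGame ℓ d κ m) (j : Fin ℓ) : Type := Fin (m j) → G.labels j

/-- Queries: one question for each player. -/
abbrev Query (G : StabilizerGame ℓ d κ m) : Type := ∀ j, G.Question j

/-- The win condition `w_x · a = b_x`. -/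
def Wins (G : StabilizerGame ℓ d κ m) (x : G.Query) (a : ∀ j, Fin (m j) → ZMod d) : Prop :=
  ∑ j, ∑ s, G.w x j s * a j s = G.b x

end StabilizerGame

/-! ### Nonlocal games, rotated, stretched and repeated games -/

/-- A nonlocal game (with `0/1`-valued win condition) whose players are indexed by `ι`, with
question sets `Q` and answer sets `A`. -/
structure NonlocalGame {ι : Type} (Q A : ι → Type) where
  dist : PMF (∀ i, Q i)
  wins : (∀ i, Q i) → (∀ i, A i) → Prop

/-- A strategy: a finite-dimensional Hilbert space `ℂ^(H i)` for each player, a density matrix on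
their tensor product, and a POVM on the player's space for each player and question. -/
structure Strategy {ι : Type} [Fintype ι] [DecidableEq ι] (Q A : ι → Type)
    [∀ i, Fintype (A i)] where
  H : ι → Type
  [fintypeH : ∀ i, Fintype (H i)]
  [decEqH : ∀ i, DecidableEq (H i)]
  ρ : Matrix (∀ i, H i) (∀ i, H i) ℂ
  ρ_pos : ρ.PosSemidef
  ρ_trace : ρ.trace = 1
  M : ∀ i, Q i → A i → Matrix (H i) (H i) ℂ
  M_pos : ∀ i x a, (M i x a).PosSemidef
  M_sum : ∀ i x, ∑ a, M i x a = 1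

namespace Strategy

attribute [instance] Strategy.fintypeH Strategy.decEqH

variable {ι : Type} [Fintype ι] [DecidableEq ι] {Q A : ι → Type} [∀ i, Fintype (A i)]

/-- Probability `Tr ((⨂ᵢ M_{x_i}^{a_i}) ρ)` that the players answer `a` to the query `x`. -/
noncomputable def prob (S : Strategy Q A) (x : ∀ i, Q i) (a : ∀ i, A i) : ℝ :=
  (Matrix.trace ((Matrix.of fun c c' : ∀ i, S.H i => ∏ i, S.M i (x i) (a i) (c i) (c' i)) *
    S.ρ)).re

end Strategy

/-- The product of finitely many distributions on finite sets (independent samples). -/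
noncomputable def pmfPi {r : ℕ} {X : Fin r → Type} [∀ i, Fintype (X i)] (π : ∀ i, PMF (X i)) :
    PMF (∀ i, X i) :=
  PMF.ofFintype (fun x => ∏ i, π i (x i)) (by
    classical
    have h := Finset.prod_univ_sum (fun i : Fin r => (Finset.univ : Finset (X i)))
      (fun i x => π i x)
    rw [Fintype.piFinset_univ] at h
    rw [← h]
    refine Finset.prod_eq_one fun i _ => ?_
    rw [← tsum_fintype (L := .unconditional _)]
    exact (π i).tsum_coe)

/-- Parallel execution of `r` games by `r` independent groups of `ℓ` players: the query distribution
is the product distribution, and the win condition is the AND of the win conditions. -/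
noncomputable def NonlocalGame.repeated {r ℓ : ℕ} {Q A : Fin r → Fin ℓ → Type}
    [∀ i j, Fintype (Q i j)] (g : ∀ i, NonlocalGame (Q i) (A i)) :
    NonlocalGame (fun p : Fin r × Fin ℓ => Q p.1 p.2) (fun p : Fin r × Fin ℓ => A p.1 p.2) where
  dist := (pmfPi fun i => (g i).dist).map fun x p => x p.1 p.2
  wins x a := ∀ i, (g i).wins (fun j => x (i, j)) (fun j => a (i, j))

open Classical in
/-- Probability that an `rℓ`-player strategy, on a query of the repeated game, wins in at least `c`
of the `r` instances. -/
noncomputable def Strategy.probWinsAtLeast {r ℓ : ℕ} {Q A : Fin r → Fin ℓ → Type}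
    [∀ i j, Fintype (Q i j)] [∀ i j, Fintype (A i j)]
    (S : Strategy (fun p : Fin r × Fin ℓ => Q p.1 p.2) (fun p : Fin r × Fin ℓ => A p.1 p.2))
    (g : ∀ i, NonlocalGame (Q i) (A i)) (c : ℝ) : ℝ :=
  ∑ x, ((NonlocalGame.repeated g).dist x).toReal *
    ∑ a with c ≤ ((Finset.univ.filter fun i : Fin r =>
      (g i).wins (fun j => x (i, j)) (fun j => a (i, j))).card : ℝ), S.prob x a

namespace StabilizerGame

variable {ℓ d : ℕ} [NeZero d] {κ κ' : Fin ℓ → Type} [∀ j, Fintype (κ j)] [∀ j, DecidableEq (κ j)]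
  [∀ j, Fintype (κ' j)] [∀ j, DecidableEq (κ' j)] {m : Fin ℓ → ℕ}

/-- Answers of player `j` in the rotated game: an answer in `ℤ_d^{m_j}` and a rotation string. -/
abbrev RotatedAnswer (d : ℕ) (κ : Fin ℓ → Type) (m : Fin ℓ → ℕ) (j : Fin ℓ) : Type :=
  (Fin (m j) → ZMod d) × PauliLabel d (κ j)

/-- The rotated stabilizer game, with win condition `w_x · (a - cor_r(x)) = b_x`. -/
noncomputable def rotated (G : StabilizerGame ℓ d κ m) :
    NonlocalGame G.Question (RotatedAnswer d κ m) where
  dist := G.dist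
  wins x a := G.Wins x fun j s => (a j).1 s - cor (a j).2 (x j s : PauliLabel d (κ j))

end StabilizerGame

/-- The Pauli label on `κ'` that is `q` on the designated qudits `e '' κ` and the identity
elsewhere. -/
noncomputable def extendLabel {d : ℕ} {κ κ' : Type} (e : κ ↪ κ') :
    PauliLabel d κ ↪ PauliLabel d κ' where
  toFun q := Function.extend e q 0
  inj' q q' h := by
    funext i
    have := congrFun h (e i)
    simpa [e.injective.extend_apply] using this

theorem extendLabel_apply {d : ℕ} {κ κ' : Type} (e : κ ↪ κ') (q : PauliLabel d κ) (i : κ) :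
    extendLabel e q (e i) = q i :=
  e.injective.extend_apply q 0 i

theorem extendLabel_apply_of_not {d : ℕ} {κ κ' : Type} (e : κ ↪ κ') (q : PauliLabel d κ) (i : κ')
    (h : ¬ ∃ a, e a = i) : extendLabel e q i = 0 :=
  Function.extend_apply' (f := e) q (fun _ => 0) i h

theorem extendLabel_comp {d : ℕ} {κ κ' : Type} (e : κ ↪ κ') (q : PauliLabel d κ) :
    (extendLabel e q) ∘ e = q := by
  funext i
  exact extendLabel_apply e q i

theorem cor_extendLabel {d : ℕ} {κ κ' : Type} [Fintype κ] [Fintype κ'] (e : κ ↪ κ')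
    (r q : PauliLabel d κ) : cor (extendLabel e r) (extendLabel e q) = cor r q := by
  classical
  unfold cor
  rw [← Finset.sum_subset (Finset.subset_univ (Finset.univ.map e)), Finset.sum_map]
  · simp only [extendLabel_apply]
  · intro i _ hi
    have : ¬ ∃ a, e a = i := by simpa using hi
    simp [extendLabel_apply_of_not e _ i this]

theorem commute_pauli_iff {d : ℕ} [NeZero d] {κ : Type} [Fintype κ] [DecidableEq κ]
    (q r : PauliLabel d κ) : Commute (pauli q) (pauli r) ↔ cor r q = 0 := by
  constructor
  · intro h
    have h1 := pauli_commutator q r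
    rw [h.eq] at h1
    have h2 := congrFun (congrFun h1 (fun i => 0 + (q i).1 + (r i).1)) 0
    rw [Matrix.smul_apply, pauli_mul_apply] at h2
    simp only [Pi.zero_apply, if_true, smul_eq_mul] at h2
    have h3 : rootPow d (∑ i, ((r i).2 * (0 + (q i).1) + (q i).2 * 0)) ≠ 0 :=
      ((ZMod.stdAddChar (N := d)).val_isUnit _).ne_zero
    have h4 : rootPow d (cor r q) = 1 := by
      by_contra hne
      apply hne
      exact (mul_eq_right₀ h3).mp h2.symm
    apply ZMod.injective_stdAddChar
    rw [AddChar.map_zero_eq_one]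
    exact h4
  · intro h
    have h1 := pauli_commutator q r
    rw [h] at h1
    simpa [rootPow, Commute, SemiconjBy] using h1

namespace StabilizerGame

variable {ℓ d : ℕ} [NeZero d] {κ κ' : Fin ℓ → Type} [∀ j, Fintype (κ j)] [∀ j, DecidableEq (κ j)]
  [∀ j, Fintype (κ' j)] [∀ j, DecidableEq (κ' j)] {m : Fin ℓ → ℕ}

/-- The query of the stretched game that corresponds to a query of the original game. -/
noncomputable def stretchQuery (G : StabilizerGame ℓ d κ m) (e : ∀ j, κ j ↪ κ' j) (x : G.Query) :
    ∀ j, Fin (m j) → ((G.labels j).map (extendLabel (e j)) : Finset (PauliLabel d (κ' j))) :=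
  fun j s => ⟨extendLabel (e j) (x j s), Finset.mem_map_of_mem _ (x j s).2⟩

/-- The query of the original game that corresponds to a query of the stretched game. -/
noncomputable def unstretchQuery (G : StabilizerGame ℓ d κ m) (e : ∀ j, κ j ↪ κ' j)
    (x : ∀ j, Fin (m j) → ((G.labels j).map (extendLabel (e j)) : Finset (PauliLabel d (κ' j)))) :
    G.Query :=
  fun j s => ⟨(x j s : PauliLabel d (κ' j)) ∘ e j, by
    obtain ⟨q, hq, hqx⟩ := Finset.mem_map.mp (x j s).2
    rw [← hqx, extendLabel_comp]
    exact hq⟩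

/-- The stretched game: player `j` has the qudits `κ' j`, among which the qudits `κ j` of the
original game are the designated ones `e j`. Every Pauli observable is extended by the identity,
and the win condition is the same. -/
noncomputable def stretch (G : StabilizerGame ℓ d κ m) (e : ∀ j, κ j ↪ κ' j) :
    StabilizerGame ℓ d κ' m where
  labels j := (G.labels j).map (extendLabel (e j))
  dist := G.dist.map (G.stretchQuery e)
  commuting := by
    intro x hx j s t
    rw [PMF.support_map] at hx
    obtain ⟨y, hy, rfl⟩ := hx
    have h := (commute_pauli_iff _ _).mp (G.commuting y hy j s t)
    rw [commute_pauli_iff]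
    simpa [stretchQuery, cor_extendLabel] using h
  w x := G.w (G.unstretchQuery e x)
  b x := G.b (G.unstretchQuery e x)

end StabilizerGame

/-! ### Perfect honest strategies -/

/-- An honest strategy for a stabilizer game: a pure state `ψ` of `∑ k_j` qudits, on which player
`j` measures the Pauli observables specified by its question. `phase` holds the scalars that turn
`X^a Z^b` into an observable over `ℤ_d` (for example `Y = i X Z` for `d = 2`); it can be `1`
whenever `σ_q ^ d = 1`. -/
structure HonestStrategy {ℓ d : ℕ} [NeZero d] {κ : Fin ℓ → Type} [∀ j, Fintype (κ j)]
    [∀ j, DecidableEq (κ j)] {m : Fin ℓ → ℕ} (G : StabilizerGame ℓ d κ m) where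
  ψ : (∀ j, κ j → ZMod d) → ℂ
  ψ_unit : ∑ c, ‖ψ c‖ ^ 2 = 1
  phase : ∀ j, G.Question j → Fin (m j) → ℂ
  norm_phase : ∀ j x s, ‖phase j x s‖ = 1
  observable : ∀ j x s, (phase j x s • pauli (x s : PauliLabel d (κ j))) ^ d = 1

namespace HonestStrategy

variable {ℓ d : ℕ} [NeZero d] {κ : Fin ℓ → Type} [∀ j, Fintype (κ j)] [∀ j, DecidableEq (κ j)]
  {m : Fin ℓ → ℕ} {G : StabilizerGame ℓ d κ m}

/-- The joint spectral projection of the `m_j` commuting observables `M_{x,1}, …, M_{x,m_j}` of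
player `j` on question `x`, for the outcomes `a`: the product over `s` of the projection
`(1/d) ∑_t ω^(-a_s t) M_{x,s}^t` on the eigenspace of `M_{x,s}` for the eigenvalue `ω^(a_s)`. -/
noncomputable def proj (S : HonestStrategy G) (j : Fin ℓ) (x : G.Question j)
    (a : Fin (m j) → ZMod d) : Matrix (κ j → ZMod d) (κ j → ZMod d) ℂ :=
  (List.ofFn fun s => (1 / (d : ℂ)) • ∑ t ∈ Finset.range d,
    rootPow d (-(a s * (t : ZMod d))) • (S.phase j x s • pauli (x s : PauliLabel d (κ j))) ^ t).prod

/-- Probability of the answers `a` to the query `x` when the players play honestly. -/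
noncomputable def prob (S : HonestStrategy G) (x : G.Query) (a : ∀ j, Fin (m j) → ZMod d) : ℝ :=
  ∑ c : ∀ j, κ j → ZMod d, ‖∑ c', (∏ j, S.proj j (x j) (a j) (c j) (c' j)) * S.ψ c'‖ ^ 2

/-- The honest strategy is perfect: on each query it wins with certainty. -/
def Perfect (S : HonestStrategy G) : Prop :=
  ∀ x ∈ G.dist.support, ∀ a, ¬ G.Wins x a → S.prob x a = 0

end HonestStrategy

/-! ### The grid, boxes, stars and input patterns -/

/-- The vertices of the `N × N` grid, with periodic boundary. -/
abbrev Grid (N : ℕ) : Type := ZMod N × ZMod N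

/-- The four directions on the grid. -/
inductive Dir where
  | right | left | up | down
  deriving DecidableEq

instance : Fintype Dir :=
  ⟨{.right, .left, .up, .down}, by intro e; cases e <;> decide⟩

/-- The opposite direction. -/
def Dir.opp : Dir → Dir
  | .right => .left
  | .left => .right
  | .up => .down
  | .down => .up

/-- The neighbour of a vertex in a direction. -/
def Dir.move {N : ℕ} : Dir → Grid N → Grid N
  | .right, v => (v.1 + 1, v.2)
  | .left, v => (v.1 - 1, v.2)
  | .up, v => (v.1, v.2 + 1)
  | .down, v => (v.1, v.2 - 1)

/-- The box of radius `L` around `u`. -/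
def box {N : ℕ} (L : ℕ) (u : Grid N) : Set (Grid N) :=
  {v | ∃ a b : ℤ, |a| ≤ L ∧ |b| ≤ L ∧ v = (u.1 + (a : ZMod N), u.2 + (b : ZMod N))}

/-- The vertices of a set that have a neighbour outside of it. -/
def gridBoundary {N : ℕ} (S : Set (Grid N)) : Set (Grid N) :=
  {v | v ∈ S ∧ ∃ e : Dir, e.move v ∉ S}

/-- A simple path on the grid with vertices `pt 0, …, pt len`; `dir t` is the direction of the
edge from `pt t` to `pt (t + 1)`. -/
structure GridPath (N : ℕ) where
  len : ℕ
  pt : Fin (len + 1) → Grid N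
  dir : Fin len → Dir
  step : ∀ t : Fin len, pt t.succ = (dir t).move (pt t.castSucc)
  simple : Function.Injective pt

/-- The vertex set of a path. -/
def GridPath.verts {N : ℕ} (p : GridPath N) : Set (Grid N) := Set.range p.pt

/-- A star with `ℓ` rays: a central box, `ℓ` further boxes, all disjoint, and `ℓ` disjoint paths;
the `j`-th path leads from the boundary of the central box to the boundary of the `j`-th box and
avoids all the boxes in between. A box is given by its centre and its radius. -/
structure GridStar (N ℓ : ℕ) where
  center : Grid N × ℕ
  leaf : Fin ℓ → Grid N × ℕ
  path : Fin ℓ → GridPath N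
  center_disjoint : ∀ j, Disjoint (box center.2 center.1) (box (leaf j).2 (leaf j).1)
  leaf_disjoint : ∀ j j', j ≠ j' →
    Disjoint (box (leaf j).2 (leaf j).1) (box (leaf j').2 (leaf j').1)
  path_disjoint : ∀ j j', j ≠ j' → Disjoint (path j).verts (path j').verts
  path_start : ∀ j, (path j).pt 0 ∈ gridBoundary (box center.2 center.1)
  path_end : ∀ j, (path j).pt (Fin.last _) ∈ gridBoundary (box (leaf j).2 (leaf j).1)
  path_inner : ∀ j t, t ≠ 0 → t ≠ Fin.last _ →
    (path j).pt t ∉ box center.2 center.1 ∧ ∀ j', (path j).pt t ∉ box (leaf j').2 (leaf j').1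

namespace GridStar

variable {N ℓ : ℕ}

/-- The central box. -/
def centralBox (Γ : GridStar N ℓ) : Set (Grid N) := box Γ.center.2 Γ.center.1

/-- The `j`-th noncentral box. -/
def leafBox (Γ : GridStar N ℓ) (j : Fin ℓ) : Set (Grid N) := box (Γ.leaf j).2 (Γ.leaf j).1

/-- The vertices in the boxes and paths of a star. -/
def verts (Γ : GridStar N ℓ) : Set (Grid N) :=
  Γ.centralBox ∪ (⋃ j, Γ.leafBox j) ∪ ⋃ j, (Γ.path j).verts

end GridStar

/-- An input pattern: `r` pairs, each of a tuple of `ℓ` input locations and a star, where the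
`j`-th location lies in the `j`-th noncentral box of the star. -/
structure InputPattern (N r ℓ : ℕ) where
  loc : Fin r → Fin ℓ → Grid N
  star : Fin r → GridStar N ℓ
  loc_mem : ∀ i j, loc i j ∈ (star i).leafBox j

/-! ### The distribution on input patterns -/

/-- `⌊N / √r⌋`, the maximal side of the squares. -/
noncomputable def maxSide (N r : ℕ) : ℕ := ⌊(N : ℝ) / √(r : ℝ)⌋₊

/-- The square of side `M` with given corner. -/
def gridSquare {N : ℕ} (M : ℕ) (u : Grid N) : Set (Grid N) :=
  {v | ∃ a b : ℕ, a < M ∧ b < M ∧ v = (u.1 + (a : ZMod N), u.2 + (b : ZMod N))}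

/-- The data from which random input patterns are sampled: `r` disjoint squares of side
`M ≤ ⌊N / √r⌋`, `T ≤ ⌊M / (2L + 1)⌋²` disjoint boxes of side `2L + 1` in each square, and for each
choice of `ℓ + 1` distinct boxes in a square a collection of `⌊L/ℓ⌋` stars in that square. -/
structure PatternSampler (N r ℓ L : ℕ) where
  ell_pos : 1 ≤ ℓ
  ell_le : ℓ ≤ L
  M : ℕ
  M_le : M ≤ maxSide N r
  M_bound : 3 * (L : ℝ) * √((ℓ : ℝ) + 1) ≤ M
  T : ℕ
  T_le : T ≤ (M / (2 * L + 1)) ^ 2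
  T_bound : ℓ + 1 ≤ T
  corner : Fin r → Grid N
  square_disjoint : ∀ i i', i ≠ i' → Disjoint (gridSquare M (corner i)) (gridSquare M (corner i'))
  boxCenter : Fin r → Fin T → Grid N
  box_subset : ∀ i b, box L (boxCenter i b) ⊆ gridSquare M (corner i)
  box_disjoint : ∀ i b b', b ≠ b' → Disjoint (box L (boxCenter i b)) (box L (boxCenter i b'))
  stars : Fin r → (Fin (ℓ + 1) ↪ Fin T) → Fin (L / ℓ) → GridStar N ℓ
  stars_center : ∀ i b s, (stars i b s).center = (boxCenter i (b 0), L)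
  stars_leaf : ∀ i b s j, (stars i b s).leaf j = (boxCenter i (b j.succ), L)
  stars_subset : ∀ i b s, (stars i b s).verts ⊆ gridSquare M (corner i)
  stars_length : ∀ i b s, ∑ j, ((stars i b s).path j).len ≤ 2 * ℓ * M
  stars_disjoint : ∀ i b s s', s ≠ s' → ∀ j j',
    Disjoint ((stars i b s).path j).verts ((stars i b s').path j').verts

namespace PatternSampler

variable {N r ℓ L : ℕ}

/-- The random choices made for one square: `ℓ + 1` distinct boxes, the position of one location
within each noncentral box, and a star from the collection. -/
abbrev Choice (T ℓ L : ℕ) : Type :=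
  (Fin (ℓ + 1) ↪ Fin T) × (Fin ℓ → Fin (2 * L + 1) × Fin (2 * L + 1)) × Fin (L / ℓ)

/-- The input pattern resulting from the random choices. -/
def toPattern (D : PatternSampler N r ℓ L) (ω : Fin r → Choice D.T ℓ L) : InputPattern N r ℓ where
  loc i j :=
    ((D.boxCenter i ((ω i).1 j.succ)).1 + (((((ω i).2.1 j).1 : ℕ) : ℤ) - (L : ℤ) : ℤ),
     (D.boxCenter i ((ω i).1 j.succ)).2 + (((((ω i).2.1 j).2 : ℕ) : ℤ) - (L : ℤ) : ℤ))
  star i := D.stars i (ω i).1 (ω i).2.2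
  loc_mem i j := by
    unfold GridStar.leafBox
    rw [D.stars_leaf]
    refine ⟨(((ω i).2.1 j).1 : ℕ) - (L : ℤ), (((ω i).2.1 j).2 : ℕ) - (L : ℤ), ?_, ?_, rfl⟩
    · have := ((ω i).2.1 j).1.2
      rw [abs_le]; omega
    · have := ((ω i).2.1 j).2.2
      rw [abs_le]; omega

theorem nonempty_choices (D : PatternSampler N r ℓ L) : Nonempty (Fin r → Choice D.T ℓ L) := by
  have h : 0 < L / ℓ := Nat.div_pos D.ell_le D.ell_pos
  exact ⟨fun _ => (Fin.castLEEmb D.T_bound, fun _ => (0, 0), ⟨0, h⟩)⟩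

/-- The distribution on input patterns: all choices are uniform and independent. -/
noncomputable def dist (D : PatternSampler N r ℓ L) : PMF (InputPattern N r ℓ) :=
  haveI := D.nonempty_choices
  (PMF.uniformOfFintype (Fin r → Choice D.T ℓ L)).map D.toPattern

end PatternSampler

/-! ### Circuit specifications and causality -/

/-- A circuit specification. -/
structure CircuitSpec (N : ℕ) where
  lightcone : Grid N → Set (Grid N)
  badIn : Set (Grid N)
  badOut : Set (Grid N)

namespace CircuitSpec

variable {N r ℓ : ℕ}

/-- The pair `i` of the pattern is individually causal with respect to the subpattern that
consists of the pairs with index in `V`. -/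
def IndividuallyCausal (spec : CircuitSpec N) (P : InputPattern N r ℓ) (V : Set (Fin r))
    (i : Fin r) : Prop :=
  (∀ j, spec.lightcone (P.loc i j) ∩ (P.star i).verts ⊆ (P.star i).leafBox j) ∧
  (∀ i' ∈ V, i' ≠ i → ∀ j, spec.lightcone (P.loc i' j) ∩ (P.star i).verts = ∅) ∧
  (P.star i).verts ∩ spec.badOut = ∅

/-- The pair `i` of the pattern is valid: its input locations are not bad. -/
def Valid (spec : CircuitSpec N) (P : InputPattern N r ℓ) (i : Fin r) : Prop :=
  ∀ j, P.loc i j ∉ spec.badIn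

/-- The subpattern of the pairs with index in `V` is causal: each of its pairs is individually
causal with respect to the subpattern, and valid. For `V = univ` this says that the pattern is
causal. -/
def Causal (spec : CircuitSpec N) (P : InputPattern N r ℓ) (V : Set (Fin r)) : Prop :=
  ∀ i ∈ V, spec.IndividuallyCausal P V i ∧ spec.Valid P i

end CircuitSpec

/-! ### Circuits -/

/-- A layered circuit on wires that carry a symbol (qudit) from the finite alphabet `A`, with inputs
and outputs indexed by the grid. Between layer `t` and layer `t + 1`, for `t < depth`, each wire of
layer `t` enters exactly one gate (`reads`) and each wire of layer `t + 1` leaves exactly one gate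
(`writes`). A gate is a quantum channel in Kraus form, with any number of output wires. Hence
unitary gates, measurements, ancillas and discarding are allowed, and so are classical
(deterministic or randomized) gates with arbitrary fan-out, whose Kraus operators are
`√p(y|x) |y … y⟩⟨x|`. A wire of layer `0` carries the basis state of an input symbol (any
number of wires may carry the same one) or a fixed ancilla symbol. All wires of the last layer are
measured in the computational basis, and `target v` is the wire with the output at `v`. The data
for `t ≥ depth` are not used. -/
structure Circuit (N : ℕ) (A : Type) [Fintype A] [DecidableEq A] where
  depth : ℕ
  width : ℕ → ℕ
  gates : ℕ → ℕ
  reads : ∀ t, Fin (width t) → Fin (gates t)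
  writes : ∀ t, Fin (width (t + 1)) → Fin (gates t)
  rank : ∀ t, Fin (gates t) → ℕ
  kraus : ∀ t (g : Fin (gates t)), Fin (rank t g) →
    Matrix ({w // writes t w = g} → A) ({w // reads t w = g} → A) ℂ
  kraus_complete : ∀ t g, ∑ e, (kraus t g e)ᴴ * kraus t g e = 1
  source : Fin (width 0) → Grid N ⊕ A
  target : Grid N → Fin (width depth)

namespace Circuit

variable {N : ℕ} {A : Type} [Fintype A] [DecidableEq A]

/-- Every gate has at most `K` input wires. -/
def FanInLE (C : Circuit N A) (K : ℕ) : Prop :=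
  ∀ t < C.depth, ∀ g : Fin (C.gates t), Fintype.card {w // C.reads t w = g} ≤ K

/-- A Kraus operator of the whole layer `t`: the tensor product of a Kraus operator per gate. -/
noncomputable def layerKraus (C : Circuit N A) (t : ℕ) (e : ∀ g, Fin (C.rank t g)) :
    Matrix (Fin (C.width (t + 1)) → A) (Fin (C.width t) → A) ℂ :=
  Matrix.of fun y x => ∏ g, C.kraus t g (e g) (fun w => y w) (fun w => x w)

/-- The state of the wires of layer `t` on a given input. -/
noncomputable def state (C : Circuit N A) (input : Grid N → A) :
    ∀ t, Matrix (Fin (C.width t) → A) (Fin (C.width t) → A) ℂ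
  | 0 =>
    let c : Fin (C.width 0) → A := fun w => Sum.elim input id (C.source w)
    Matrix.single c c 1
  | t + 1 => ∑ e, C.layerKraus t e * C.state input t * (C.layerKraus t e)ᴴ

open Classical in
/-- Probability that the circuit outputs `y` on the given input. -/
noncomputable def outProb (C : Circuit N A) (input y : Grid N → A) : ℝ :=
  ∑ c : Fin (C.width C.depth) → A with ∀ v, c (C.target v) = y v,
    (C.state input C.depth c c).re

/-- Vertices of the circuit graph: input vertices, gates and output vertices. -/
inductive Vertex (C : Circuit N A) where
  | input (u : Grid N)
  | gate (t : ℕ) (g : Fin (C.gates t))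
  | output (v : Grid N)

/-- Edges of the circuit graph: there is an edge for each wire. -/
inductive Edge (C : Circuit N A) : C.Vertex → C.Vertex → Prop where
  | inputGate (u : Grid N) (w : Fin (C.width 0)) :
      0 < C.depth → C.source w = Sum.inl u → Edge C (.input u) (.gate 0 (C.reads 0 w))
  | gateGate (t : ℕ) (w : Fin (C.width (t + 1))) :
      t + 1 < C.depth → Edge C (.gate t (C.writes t w)) (.gate (t + 1) (C.reads (t + 1) w))
  | gateOutput (t : ℕ) (w : Fin (C.width (t + 1))) (v : Grid N) :
      t + 1 = C.depth → (C.target v : ℕ) = w → Edge C (.gate t (C.writes t w)) (.output v)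
  | inputOutput (u : Grid N) (w : Fin (C.width 0)) (v : Grid N) :
      C.depth = 0 → (C.target v : ℕ) = w → C.source w = Sum.inl u → Edge C (.input u) (.output v)

/-- The input vertices from which there is a path to `v` in the circuit graph. -/
def backwardLightcone (C : Circuit N A) (v : C.Vertex) : Set (Grid N) :=
  {u | Relation.ReflTransGen C.Edge (.input u) v}

/-- The output vertices to which there is a path from the input vertex `u`. -/
def forwardLightcone (C : Circuit N A) (u : Grid N) : Set (Grid N) :=
  {v | u ∈ C.backwardLightcone (.output v)}

end Circuit

/-! ### The circuit game -/

/-- The maximal number `k = max_j k_j` of qudits of a player. -/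
def maxQudits {ℓ : ℕ} (k : Fin ℓ → ℕ) : ℕ := Finset.univ.sup k

theorem le_maxQudits {ℓ : ℕ} (k : Fin ℓ → ℕ) (j : Fin ℓ) : k j ≤ maxQudits k :=
  Finset.le_sup (Finset.mem_univ j)

/-- The extension of the paths of the stars of a pattern inside the boxes. The `j`-th route of the
`i`-th star leads from a vertex `g` of the central box to the `j`-th input location and
consists of vertices of the central box, the `j`-th path of the star, and vertices of the `j`-th
box. The group of qudits of the vertex `g` that faces the direction `share i j`, which is not the
direction of the route, holds the share of player `j` of the state `ψ`. -/
structure Wiring {N r ℓ : ℕ} (P : InputPattern N r ℓ) where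
  route : Fin r → Fin ℓ → GridPath N
  share : Fin r → Fin ℓ → Dir
  route_end : ∀ i j, (route i j).pt (Fin.last _) = P.loc i j
  route_extends : ∀ i j, ∃ B E : List (Grid N),
    List.ofFn (route i j).pt = B ++ List.ofFn ((P.star i).path j).pt ++ E ∧
    (∀ v ∈ B, v ∈ (P.star i).centralBox) ∧ ∀ v ∈ E, v ∈ (P.star i).leafBox j
  route_disjoint : ∀ i j j', j ≠ j' → Disjoint (route i j).verts (route i j').verts
  share_ne : ∀ i j (t : Fin (route i j).len), (t : ℕ) = 0 → share i j ≠ (route i j).dir t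

/-- The direction of the group of qudits at the `t`-th vertex of a route that faces the previous
vertex of the route; at the first vertex, the direction of the group that holds a share of `ψ`. -/
def Wiring.inDir {N r ℓ : ℕ} {P : InputPattern N r ℓ} (W : Wiring P) (i : Fin r) (j : Fin ℓ) :
    Fin ((W.route i j).len + 1) → Dir :=
  Fin.cases (W.share i j) fun t => ((W.route i j).dir t).opp

/-- The natural input symbols at a grid vertex: no operation; first vertex of the `j`-th route of a
star, with the directions of the share of `ψ` and of the next vertex; inner vertex of a route, with
the directions of the previous and of the next vertex (a teleportation measurement is performed
between the groups of qudits facing these directions); input location of player `j`, with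
the player's question and the direction of the group of qudits to be measured. -/
inductive InputSymbol {ℓ : ℕ} (Q : Fin ℓ → Type) where
  | idle
  | start (j : Fin ℓ) (share next : Dir)
  | inner (prev next : Dir)
  | question (j : Fin ℓ) (q : Q j) (prev : Dir)

/-- The data that determine the circuit game: a stabilizer game with a perfect honest
strategy, the distribution on input patterns, an extension of the paths of each pattern inside the
boxes, and embeddings of the natural input and output symbols (questions and teleportation
instructions; answers and teleportation outcomes) in the alphabet `A`. -/
structure CircuitGame (ℓ d : ℕ) [NeZero d] (k m : Fin ℓ → ℕ) (N r L : ℕ) (A : Type) where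
  game : StabilizerGame ℓ d (fun j => Fin (k j)) m
  honest : HonestStrategy game
  perfect : honest.Perfect
  sampler : PatternSampler N r ℓ L
  wiring : ∀ P : InputPattern N r ℓ, Wiring P
  encIn : InputSymbol game.Question ↪ A
  encAns : ∀ j, (Fin (m j) → ZMod d) ↪ A
  encTel : (Fin (maxQudits k) → ZMod d × ZMod d) ↪ A

namespace CircuitGame

variable {ℓ d : ℕ} [NeZero d] {k m : Fin ℓ → ℕ} {N r L : ℕ} {A : Type}

/-- `r`-tuples of queries. -/
abbrev Queries (𝒢 : CircuitGame ℓ d k m N r L A) : Type := Fin r → 𝒢.game.Query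

open Classical in
/-- The natural input symbol at a vertex of the grid. -/
noncomputable def inputSymbol (𝒢 : CircuitGame ℓ d k m N r L A) (P : InputPattern N r ℓ)
    (x : 𝒢.Queries) (v : Grid N) : InputSymbol 𝒢.game.Question :=
  let W := 𝒢.wiring P
  if h : ∃ s : Σ i : Fin r, Σ j : Fin ℓ, Fin ((W.route i j).len + 1),
      (W.route s.1 s.2.1).pt s.2.2 = v then
    let s := h.choose
    if ht : (s.2.2 : ℕ) < (W.route s.1 s.2.1).len then
      if (s.2.2 : ℕ) = 0 then
        .start s.2.1 (W.share s.1 s.2.1) ((W.route s.1 s.2.1).dir ⟨s.2.2, ht⟩)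
      else .inner (W.inDir s.1 s.2.1 s.2.2) ((W.route s.1 s.2.1).dir ⟨s.2.2, ht⟩)
    else .question s.2.1 (x s.1 s.2.1) (W.inDir s.1 s.2.1 s.2.2)
  else .idle

/-- The input string to the circuit that encodes a pattern and an `r`-tuple of queries. -/
noncomputable def encode (𝒢 : CircuitGame ℓ d k m N r L A) (P : InputPattern N r ℓ)
    (x : 𝒢.Queries) : Grid N → A :=
  fun v => 𝒢.encIn (𝒢.inputSymbol P x v)

/-- The qudits on the grid: a group of `k` qudits for each vertex and direction. -/
abbrev Qudit (N : ℕ) {ℓ : ℕ} (k : Fin ℓ → ℕ) : Type := Grid N × Dir × Fin (maxQudits k)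

/-- A group of qudits that holds a share of a copy of `ψ`. -/
def IsShare {P : InputPattern N r ℓ} (W : Wiring P) (v : Grid N) (e : Dir) : Prop :=
  ∃ i j, v = (W.route i j).pt 0 ∧ e = W.share i j

open Classical in
/-- The contribution to the amplitude of the group at `v` that faces `e` and the group opposite to
it: maximally entangled states, unless one of the groups holds a share of `ψ`; in this case the
other one, if it does not hold a share itself, is in the state `|0⟩`. -/
noncomputable def linkAmp [NeZero N] {P : InputPattern N r ℓ} (W : Wiring P)
    (c : Qudit N k → ZMod d) (v : Grid N) (e : Dir) : ℂ :=
  if IsShare W v e then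
    if IsShare W (e.move v) e.opp then 1
    else ∏ s, if c (e.move v, e.opp, s) = 0 then 1 else 0
  else
    if IsShare W (e.move v) e.opp then ∏ s, if c (v, e, s) = 0 then 1 else 0
    else ∏ s, if c (v, e, s) = c (e.move v, e.opp, s) then 1 / (√(d : ℝ) : ℂ) else 0

/-- The amplitude of `ψ`, padded with `|0⟩` to `k` qudits for each player. -/
noncomputable def paddedψ (𝒢 : CircuitGame ℓ d k m N r L A)
    (c : Fin ℓ → Fin (maxQudits k) → ZMod d) : ℂ :=
  𝒢.honest.ψ (fun j s => c j (Fin.castLE (le_maxQudits k j) s)) *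
    ∏ j, ∏ s : Fin (maxQudits k), if (s : ℕ) < k j ∨ c j s = 0 then 1 else 0

/-- The state prepared in the first stage of the ideal circuit. -/
noncomputable def idealState [NeZero N] (𝒢 : CircuitGame ℓ d k m N r L A)
    (P : InputPattern N r ℓ) (c : Qudit N k → ZMod d) : ℂ :=
  (∏ v, linkAmp (𝒢.wiring P) c v .right * linkAmp (𝒢.wiring P) c v .up) *
    ∏ i, 𝒢.paddedψ fun j s => c (((𝒢.wiring P).route i j).pt 0, (𝒢.wiring P).share i j, s)

/-- The amplitudes of the state `(Z^b ⊗ X^a) (1/√d) ∑ᵢ |i i⟩` of a Bell basis. -/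
noncomputable def bellAmp (o : ZMod d × ZMod d) (cin cout : ZMod d) : ℂ :=
  if cout = cin + o.1 then rootPow d (o.2 * cin) / (√(d : ℝ) : ℂ) else 0

/-- Outcomes of the ideal circuit: for each route, the outcomes of the teleportation measurements at
all its vertices but the last one, and an answer in the stabilizer game. -/
abbrev IdealOutcome (𝒢 : CircuitGame ℓ d k m N r L A) (P : InputPattern N r ℓ) : Type :=
  ∀ i j, (Fin ((𝒢.wiring P).route i j).len → Fin (maxQudits k) → ZMod d × ZMod d) ×
    (Fin (m j) → ZMod d)

/-- The qudits that are measured by the ideal circuit. -/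
def Measured (𝒢 : CircuitGame ℓ d k m N r L A) (P : InputPattern N r ℓ) (q : Qudit N k) : Prop :=
  let W := 𝒢.wiring P
  ∃ i j,
    (∃ (t : Fin (W.route i j).len) (s : Fin (maxQudits k)),
      q = ((W.route i j).pt t.castSucc, W.inDir i j t.castSucc, s) ∨
      q = ((W.route i j).pt t.castSucc, (W.route i j).dir t, s)) ∨
    ∃ s : Fin (k j), q = (P.loc i j, W.inDir i j (Fin.last _), Fin.castLE (le_maxQudits k j) s)

open Classical in
/-- The projection for the outcome `o` of the measurements in the ideal circuit: at each vertex of a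
route but the last one, a Bell measurement between the group of qudits facing the previous vertex
(at the first vertex, the share of `ψ`) and the group facing the next one; at each input location,
the honest measurement of the player's question on the qudits that arrive there; the identity on
all other qudits. -/
noncomputable def idealProj (𝒢 : CircuitGame ℓ d k m N r L A) (P : InputPattern N r ℓ)
    (x : 𝒢.Queries) (o : 𝒢.IdealOutcome P) (c c' : Qudit N k → ZMod d) : ℂ :=
  let W := 𝒢.wiring P
  (∏ i, ∏ j,
    (∏ t : Fin (W.route i j).len, ∏ s : Fin (maxQudits k),
      bellAmp ((o i j).1 t s)
          (c ((W.route i j).pt t.castSucc, W.inDir i j t.castSucc, s))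
          (c ((W.route i j).pt t.castSucc, (W.route i j).dir t, s)) *
        (starRingEnd ℂ) (bellAmp ((o i j).1 t s)
          (c' ((W.route i j).pt t.castSucc, W.inDir i j t.castSucc, s))
          (c' ((W.route i j).pt t.castSucc, (W.route i j).dir t, s)))) *
    𝒢.honest.proj j (x i j) (o i j).2
      (fun s => c (P.loc i j, W.inDir i j (Fin.last _), Fin.castLE (le_maxQudits k j) s))
      (fun s => c' (P.loc i j, W.inDir i j (Fin.last _), Fin.castLE (le_maxQudits k j) s))) *
  if ∀ q, 𝒢.Measured P q ∨ c q = c' q then 1 else 0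

/-- Probability of the outcome `o` of the ideal circuit. -/
noncomputable def idealProb [NeZero N] (𝒢 : CircuitGame ℓ d k m N r L A) (P : InputPattern N r ℓ)
    (x : 𝒢.Queries) (o : 𝒢.IdealOutcome P) : ℝ :=
  ∑ c, ‖∑ c', 𝒢.idealProj P x o c c' * 𝒢.idealState P c'‖ ^ 2

/-- The distribution of the input to the circuit game: independently, an input pattern and an
`r`-tuple of independent queries. -/
noncomputable def dist (𝒢 : CircuitGame ℓ d k m N r L A) : PMF (InputPattern N r ℓ × 𝒢.Queries) :=
  𝒢.sampler.dist.bind fun P => (pmfPi fun _ : Fin r => 𝒢.game.dist).map fun x => (P, x)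

/-- The relation of the circuit game: on an input in the support of the input distribution, the
output symbols along the routes are in the support of the output distribution of the ideal
circuit (other output symbols are irrelevant). -/
def relation [NeZero N] (𝒢 : CircuitGame ℓ d k m N r L A) :
    Set ((InputPattern N r ℓ × 𝒢.Queries) × (Grid N → A)) :=
  {z | z.1 ∈ 𝒢.dist.support ∧ ∃ o : 𝒢.IdealOutcome z.1.1, 𝒢.idealProb z.1.1 z.1.2 o ≠ 0 ∧
    ∀ i j, (∀ t, z.2 (((𝒢.wiring z.1.1).route i j).pt t.castSucc) = 𝒢.encTel ((o i j).1 t)) ∧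
      z.2 (z.1.1.loc i j) = 𝒢.encAns j (o i j).2}

open Classical in
/-- Probability that the circuit wins on a given input. -/
noncomputable def winProbOn [NeZero N] [Fintype A] [DecidableEq A]
    (𝒢 : CircuitGame ℓ d k m N r L A) (C : Circuit N A) (z : InputPattern N r ℓ × 𝒢.Queries) : ℝ :=
  ∑ y : Grid N → A with (z, y) ∈ 𝒢.relation, C.outProb (𝒢.encode z.1 z.2) y

/-- Probability that the circuit wins, conditioned on the input pattern being `P`. -/
noncomputable def condWinProb [NeZero N] [Fintype A] [DecidableEq A]
    (𝒢 : CircuitGame ℓ d k m N r L A) (C : Circuit N A) (P : InputPattern N r ℓ) : ℝ :=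
  (∑ x, (𝒢.dist (P, x)).toReal * 𝒢.winProbOn C (P, x)) / ∑ x, (𝒢.dist (P, x)).toReal

/-! ### The stretched game obtained from a pattern, and decoding -/

/-- A partition of the vertices of each star of the pattern into sets `region i j`, one for each
player, that contain the routes of the players. -/
structure Regions {P : InputPattern N r ℓ} (W : Wiring P) where
  region : Fin r → Fin ℓ → Finset (Grid N)
  disjoint : ∀ i j j', j ≠ j' → Disjoint (region i j) (region i j')
  cover : ∀ i v, v ∈ (P.star i).verts ↔ ∃ j, v ∈ region i j
  route_mem : ∀ i j t, (W.route i j).pt t ∈ region i j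

namespace Regions

variable {P : InputPattern N r ℓ} {W : Wiring P}

/-- The qudits of player `j` in the stretched game for the `i`-th star: `k` for each vertex. -/
abbrev StretchedQudit (Γ : Regions W) (k : Fin ℓ → ℕ) (i : Fin r) (j : Fin ℓ) : Type :=
  {v // v ∈ Γ.region i j} × Fin (maxQudits k)

theorem loc_mem (Γ : Regions W) (i : Fin r) (j : Fin ℓ) : P.loc i j ∈ Γ.region i j :=
  W.route_end i j ▸ Γ.route_mem i j (Fin.last _)

/-- The designated qudits of player `j`: the first `k_j` qudits at the input location. -/
def designated (Γ : Regions W) (k : Fin ℓ → ℕ) (i : Fin r) (j : Fin ℓ) :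
    Fin (k j) ↪ Γ.StretchedQudit k i j where
  toFun s := (⟨P.loc i j, Γ.loc_mem i j⟩, Fin.castLE (le_maxQudits k j) s)
  inj' s s' h := by simpa using h

end Regions

variable (𝒢 : CircuitGame ℓ d k m N r L A) {P : InputPattern N r ℓ}

/-- The stretched game for the `i`-th star. -/
noncomputable def stretchedGame (Γ : Regions (𝒢.wiring P)) (i : Fin r) :
    StabilizerGame ℓ d (Γ.StretchedQudit k i) m :=
  𝒢.game.stretch fun j => Γ.designated k i j

/-- The rotated stretched game for the `i`-th star. -/
noncomputable def instanceGame (Γ : Regions (𝒢.wiring P)) (i : Fin r) :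
    NonlocalGame (𝒢.stretchedGame Γ i).Question
      (StabilizerGame.RotatedAnswer d (Γ.StretchedQudit k i) m) :=
  (𝒢.stretchedGame Γ i).rotated

/-- Question sets of the repeated rotated stretched game. -/
abbrev PlayerQuestion (Γ : Regions (𝒢.wiring P)) (p : Fin r × Fin ℓ) : Type :=
  (𝒢.stretchedGame Γ p.1).Question p.2

/-- Answer sets of the repeated rotated stretched game. -/
abbrev PlayerAnswer (Γ : Regions (𝒢.wiring P)) (p : Fin r × Fin ℓ) : Type :=
  StabilizerGame.RotatedAnswer d (Γ.StretchedQudit k p.1) m p.2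

/-- The questions in the repeated rotated stretched game that correspond to an `r`-tuple of
queries. -/
noncomputable def playerQuestions (Γ : Regions (𝒢.wiring P)) (x : 𝒢.Queries) :
    ∀ p, 𝒢.PlayerQuestion Γ p :=
  fun p => 𝒢.game.stretchQuery (fun j => Γ.designated k p.1 j) (x p.1) p.2

/-- Decoding of a symbol as a teleportation outcome. -/
noncomputable def decTel (σ : A) : Fin (maxQudits k) → ZMod d × ZMod d :=
  Function.invFun 𝒢.encTel σ

open Classical in
/-- Decoding of an output of the circuit as answers in the repeated rotated stretched game. The
answer of player `(i, j)` is computed from the output symbols in `region i j` alone. The rotation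
string consists of the teleportation outcomes at all the vertices other than the input location; at
the input location it is the total Pauli correction `X^(∑ a) Z^(-∑ b)` along the route. -/
noncomputable def decode (Γ : Regions (𝒢.wiring P)) (y : Grid N → A) : ∀ p, 𝒢.PlayerAnswer Γ p :=
  fun p =>
    (Function.invFun (𝒢.encAns p.2) (y (P.loc p.1 p.2)),
     fun q =>
      if (q.1 : Grid N) = P.loc p.1 p.2 then
        (∑ t : Fin ((𝒢.wiring P).route p.1 p.2).len,
            (𝒢.decTel (y (((𝒢.wiring P).route p.1 p.2).pt t.castSucc)) q.2).1,
         -∑ t : Fin ((𝒢.wiring P).route p.1 p.2).len,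
            (𝒢.decTel (y (((𝒢.wiring P).route p.1 p.2).pt t.castSucc)) q.2).2)
      else 𝒢.decTel (y q.1) q.2)

end CircuitGame

/-!
The simulation runs the circuit in the Heisenberg picture: the measurement that decodes the output
is pulled back through the circuit, one layer at a time. A gate that depends on no question acts on
registers shared by all players and can be absorbed in their entangled state; a gate that depends on
the question of a single player acts on registers of that player; and a gate that depends on the
questions of several players reaches, by causality, no region that is decoded, hence disappears
because channels preserve the trace. So the effects stay those of a local measurement, and at the
input they become a strategy.

Along a route, translating the computational basis by the same amount on all qudits leaves the
entangled pairs invariant, translates the copy of `ψ`, and multiplies each Bell amplitude by a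
phase. Hence the honest measurement at the end of the route acts on `ψ` as the honest measurement
conjugated by the accumulated Pauli correction, and every outcome in the ideal support wins the
rotated game.

The questions of the invalid pairs are fixed at values for which the probability of winning is at
least its average.
-/

section PiKronecker

variable {ι α : Type*} [Fintype ι] {m n p : ι → Type*}

/-- The tensor product `⨂ i, M i` of a finite family of matrices, as a matrix indexed by families of
indices. -/
def piKronecker [CommMonoid α] (M : ∀ i, Matrix (m i) (n i) α) :
    Matrix (∀ i, m i) (∀ i, n i) α :=
  .of fun c d => ∏ i, M i (c i) (d i)

theorem piKronecker_apply [CommMonoid α] (M : ∀ i, Matrix (m i) (n i) α) (c : ∀ i, m i)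
    (d : ∀ i, n i) : piKronecker M c d = ∏ i, M i (c i) (d i) := rfl

theorem piKronecker_mul_piKronecker [CommSemiring α] [DecidableEq ι] [∀ i, Fintype (n i)]
    (M : ∀ i, Matrix (m i) (n i) α) (M' : ∀ i, Matrix (n i) (p i) α) :
    piKronecker M * piKronecker M' = piKronecker fun i => M i * M' i := by
  ext c d
  simp only [Matrix.mul_apply, piKronecker_apply, ← Finset.prod_mul_distrib, Fintype.prod_sum]

theorem conjTranspose_piKronecker [CommSemiring α] [StarRing α] (M : ∀ i, Matrix (m i) (n i) α) :
    (piKronecker M)ᴴ = piKronecker fun i => (M i)ᴴ := by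
  ext c d
  simp only [Matrix.conjTranspose_apply, piKronecker_apply, star_prod]

theorem piKronecker_one [CommSemiring α] [∀ i, DecidableEq (m i)] [DecidableEq (∀ i, m i)] :
    piKronecker (fun i => (1 : Matrix (m i) (m i) α)) = 1 := by
  ext c d
  rw [piKronecker_apply, Matrix.one_apply]
  split_ifs with h
  · exact Finset.prod_eq_one fun i _ => by rw [h, Matrix.one_apply_eq]
  · obtain ⟨i, hi⟩ := Function.ne_iff.mp h
    exact Finset.prod_eq_zero (Finset.mem_univ i) (Matrix.one_apply_ne hi)

theorem sum_piKronecker [CommSemiring α] [DecidableEq ι] {R : ι → Type*} [∀ i, Fintype (R i)]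
    (M : ∀ i, R i → Matrix (m i) (n i) α) :
    ∑ e : ∀ i, R i, piKronecker (fun i => M i (e i)) = piKronecker fun i => ∑ e, M i e := by
  ext c d
  simp only [Matrix.sum_apply, piKronecker_apply, Fintype.prod_sum]

open scoped Kronecker in
theorem piKronecker_kronecker [CommSemiring α] {m' n' : ι → Type*}
    (M : ∀ i, Matrix (m i) (n i) α) (M' : ∀ i, Matrix (m' i) (n' i) α) :
    piKronecker (fun i => M i ⊗ₖ M' i) = (piKronecker M ⊗ₖ piKronecker M').submatrix
      (Equiv.arrowProdEquivProdArrow ι m m') (Equiv.arrowProdEquivProdArrow ι n n') := by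
  ext c d
  exact Finset.prod_mul_distrib

end PiKronecker

theorem sum_pi_prod {ι M : Type*} [Fintype ι] [DecidableEq ι] [AddCommMonoid M] {B C : ι → Type*}
    [∀ i, Fintype (B i)] [∀ i, Fintype (C i)] (φ : (∀ i, B i × C i) → M) :
    ∑ c, φ c = ∑ b : ∀ i, B i, ∑ c : ∀ i, C i, φ fun i => (b i, c i) := by
  rw [← (Equiv.arrowProdEquivProdArrow ι B C).symm.sum_comp, Fintype.sum_prod_type]
  rfl

/-! ### Local measurements -/

section LocalMeasurement

open scoped Kronecker

theorem kronecker_sum {α κ l m n p : Type*} [NonUnitalNonAssocSemiring α] (s : Finset κ)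
    (M : Matrix l m α) (M' : κ → Matrix n p α) : ∑ f ∈ s, M ⊗ₖ M' f = M ⊗ₖ ∑ f ∈ s, M' f := by
  ext
  simp only [Matrix.sum_apply, Matrix.kroneckerMap_apply, Finset.mul_sum]

theorem sum_kronecker {α κ l m n p : Type*} [NonUnitalNonAssocSemiring α] (s : Finset κ)
    (M : κ → Matrix l m α) (M' : Matrix n p α) : ∑ f ∈ s, M f ⊗ₖ M' = (∑ f ∈ s, M f) ⊗ₖ M' := by
  ext
  simp only [Matrix.sum_apply, Matrix.kroneckerMap_apply, Finset.sum_mul]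

/-- The operator `V`, which distributes a register among parties, extended by the identity on the
registers that the parties hold already. -/
def distribute {ι S : Type} {R : ι → Type} (B : ι → Type) [Fintype ι] [∀ i, DecidableEq (B i)]
    (V : Matrix (∀ i, R i) S ℂ) : Matrix (∀ i, R i × B i) (S × ∀ i, B i) ℂ :=
  (V ⊗ₖ piKronecker fun i => (1 : Matrix (B i) (B i) ℂ)).submatrix
    (Equiv.arrowProdEquivProdArrow ι R B) id

theorem distribute_apply {ι S : Type} {R B : ι → Type} [Fintype ι] [DecidableEq (∀ i, B i)]
    [∀ i, DecidableEq (B i)] (V : Matrix (∀ i, R i) S ℂ) (r : ∀ i, R i) (c : ∀ i, B i) (s : S)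
    (b : ∀ i, B i) :
    distribute B V (fun i => (r i, c i)) (s, b) = V r s * if c = b then 1 else 0 := by
  rw [distribute, piKronecker_one, ← Matrix.one_apply]
  rfl

theorem distribute_mul_kronecker {ι S S' : Type} {R B B' : ι → Type} [Fintype ι] [DecidableEq ι]
    [Fintype S] [∀ i, Fintype (R i)] [∀ i, DecidableEq (R i)] [∀ i, Fintype (B i)]
    [∀ i, DecidableEq (B i)] [∀ i, Fintype (B' i)] [∀ i, DecidableEq (B' i)]
    (V : Matrix (∀ i, R i) S ℂ) (κs : Matrix S S' ℂ) (κ : ∀ i, Matrix (B i) (B' i) ℂ) :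
    distribute B V * (κs ⊗ₖ piKronecker κ) =
      piKronecker (fun i => (1 : Matrix (R i) (R i) ℂ) ⊗ₖ κ i) * distribute B' (V * κs) := by
  rw [distribute, distribute, piKronecker_kronecker, Matrix.submatrix_mul_equiv,
    ← Matrix.mul_kronecker_mul, piKronecker_mul_piKronecker, piKronecker_one,
    ← Matrix.submatrix_id_id (κs ⊗ₖ _), ← Equiv.coe_refl, Matrix.submatrix_mul_equiv,
    ← Matrix.mul_kronecker_mul]
  simp only [piKronecker_one, Matrix.one_mul, Matrix.mul_one]

/-- The effect of distributing a register by the Kraus operators `V e` and observing the effect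
`M i` on the registers of each party `i`. -/
def localEffect {ι S E : Type} {R B : ι → Type} [Fintype ι] [Fintype E] [∀ i, Fintype (R i)]
    [∀ i, Fintype (B i)] [∀ i, DecidableEq (B i)] [DecidableEq ι] (V : E → Matrix (∀ i, R i) S ℂ)
    (M : ∀ i, Matrix (R i × B i) (R i × B i) ℂ) : Matrix (S × ∀ i, B i) (S × ∀ i, B i) ℂ :=
  ∑ e, (distribute B (V e))ᴴ * piKronecker M * distribute B (V e)

section LocalEffect

variable {ι S S' E F : Type} {R B B' Fi : ι → Type} [Fintype ι] [DecidableEq ι] [Fintype E]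
  [Fintype F] [∀ i, Fintype (R i)] [∀ i, Fintype (B i)] [∀ i, DecidableEq (B i)]

theorem localEffect_apply (V : E → Matrix (∀ i, R i) S ℂ)
    (M : ∀ i, Matrix (R i × B i) (R i × B i) ℂ) (s s' : S) (b b' : ∀ i, B i) :
    localEffect V M (s, b) (s', b') = ∑ e, ∑ r', ∑ r, star (V e r s) *
      (∏ i, M i (r i, b i) (r' i, b' i)) * V e r' s' := by
  simp only [localEffect, Matrix.sum_apply, Matrix.mul_apply, Matrix.conjTranspose_apply,
    sum_pi_prod, distribute_apply, piKronecker_apply, mul_ite, mul_one, mul_zero, apply_ite star,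
    star_zero, ite_mul, zero_mul, Finset.sum_ite_eq', Finset.mem_univ, if_true]
  simp only [Finset.sum_mul]

theorem localEffect_kraus [Fintype S] [∀ i, DecidableEq (R i)] [∀ i, Fintype (B' i)]
    [∀ i, DecidableEq (B' i)] [∀ i, Fintype (Fi i)] (V : E → Matrix (∀ i, R i) S ℂ)
    (M : ∀ i, Matrix (R i × B i) (R i × B i) ℂ) (κs : F → Matrix S S' ℂ)
    (κ : ∀ i, Fi i → Matrix (B i) (B' i) ℂ) :
    localEffect (fun e : E × F => V e.1 * κs e.2) (fun i =>
        ∑ f, ((1 : Matrix (R i) (R i) ℂ) ⊗ₖ κ i f)ᴴ * M i * ((1 : Matrix (R i) (R i) ℂ) ⊗ₖ κ i f)) =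
      ∑ f, ∑ fi : ∀ i, Fi i, (κs f ⊗ₖ piKronecker fun i => κ i (fi i))ᴴ * localEffect V M *
        (κs f ⊗ₖ piKronecker fun i => κ i (fi i)) := by
  have hterm : ∀ e f (fi : ∀ i, Fi i), (distribute B' (V e * κs f))ᴴ *
      piKronecker (fun i => ((1 : Matrix (R i) (R i) ℂ) ⊗ₖ κ i (fi i))ᴴ * M i *
        ((1 : Matrix (R i) (R i) ℂ) ⊗ₖ κ i (fi i))) * distribute B' (V e * κs f) =
        (κs f ⊗ₖ piKronecker fun i => κ i (fi i))ᴴ *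
          ((distribute B (V e))ᴴ * piKronecker M * distribute B (V e)) *
          (κs f ⊗ₖ piKronecker fun i => κ i (fi i)) := fun e f fi => by
    have h := congrArg (fun X => Xᴴ * piKronecker M * X)
      (distribute_mul_kronecker (V e) (κs f) fun i => κ i (fi i))
    simp only [← piKronecker_mul_piKronecker, ← conjTranspose_piKronecker,
      Matrix.conjTranspose_mul, Matrix.mul_assoc] at h ⊢
    exact h.symm
  unfold localEffect
  rw [Fintype.sum_prod_type_right]
  simp only [← sum_piKronecker, Matrix.mul_sum, Matrix.sum_mul, hterm]
  exact Finset.sum_congr rfl fun f _ => Finset.sum_comm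

end LocalEffect

/-- A joint measurement, with answers in `Ans i` for each party `i`, of registers `B i` held by the
parties and a register `S` held by nobody: first `S` is distributed to the parties by the channel
with Kraus operators `share e`, then each party `i` measures its share, which lives in `R i`,
together with its register. -/
structure LocalMeasurement {ι : Type} [Fintype ι] [DecidableEq ι] (S : Type) [Fintype S]
    [DecidableEq S] (B Ans : ι → Type) [∀ i, Fintype (B i)] [∀ i, DecidableEq (B i)]
    [∀ i, Fintype (Ans i)] where
  R : ι → Type
  [fintypeR : ∀ i, Fintype (R i)]
  [decEqR : ∀ i, DecidableEq (R i)]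
  Env : Type
  [fintypeEnv : Fintype Env]
  share : Env → Matrix (∀ i, R i) S ℂ
  share_complete : ∑ e, (share e)ᴴ * share e = 1
  M : ∀ i, Ans i → Matrix (R i × B i) (R i × B i) ℂ
  M_pos : ∀ i a, (M i a).PosSemidef
  M_sum : ∀ i, ∑ a, M i a = 1

namespace LocalMeasurement

attribute [instance] fintypeR decEqR fintypeEnv

variable {ι : Type} [Fintype ι] [DecidableEq ι] {S S' : Type} [Fintype S] [DecidableEq S]
  [Fintype S'] [DecidableEq S'] {B B' Ans : ι → Type} [∀ i, Fintype (B i)]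
  [∀ i, DecidableEq (B i)] [∀ i, Fintype (B' i)] [∀ i, DecidableEq (B' i)] [∀ i, Fintype (Ans i)]

/-- The effect (POVM element) of the answers `a`. -/
def effect (D : LocalMeasurement S B Ans) (a : ∀ i, Ans i) :
    Matrix (S × ∀ i, B i) (S × ∀ i, B i) ℂ :=
  localEffect D.share fun i => D.M i (a i)

/-- Channels with Kraus operators `κs` on the register held by nobody and `κ i` on the register of
party `i`, followed by a local measurement. -/
def precomp (D : LocalMeasurement S B Ans) {F : Type} [Fintype F] {Fi : ι → Type}
    [∀ i, Fintype (Fi i)] (κs : F → Matrix S S' ℂ) (hκs : ∑ f, (κs f)ᴴ * κs f = 1)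
    (κ : ∀ i, Fi i → Matrix (B i) (B' i) ℂ) (hκ : ∀ i, ∑ f, (κ i f)ᴴ * κ i f = 1) :
    LocalMeasurement S' B' Ans where
  R := D.R
  Env := D.Env × F
  share e := D.share e.1 * κs e.2
  share_complete := by
    simp only [Matrix.conjTranspose_mul, Matrix.mul_assoc, Fintype.sum_prod_type_right]
    simp only [← Matrix.mul_sum, ← Matrix.mul_assoc (D.share _)ᴴ, ← Matrix.sum_mul,
      D.share_complete, Matrix.one_mul, hκs]
  M i a := ∑ f, ((1 : Matrix (D.R i) (D.R i) ℂ) ⊗ₖ κ i f)ᴴ * D.M i a * (1 ⊗ₖ κ i f)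
  M_pos i a := Matrix.posSemidef_sum _ fun f _ => (D.M_pos i a).conjTranspose_mul_mul_same _
  M_sum i := by
    rw [Finset.sum_comm]
    simp only [← Matrix.sum_mul, ← Matrix.mul_sum, D.M_sum, Matrix.mul_one,
      Matrix.conjTranspose_kronecker, ← Matrix.mul_kronecker_mul, Matrix.conjTranspose_one]
    simp only [kronecker_sum, hκ, Matrix.one_kronecker_one]

theorem effect_precomp (D : LocalMeasurement S B Ans) {F : Type} [Fintype F] {Fi : ι → Type}
    [∀ i, Fintype (Fi i)] (κs : F → Matrix S S' ℂ) (hκs : ∑ f, (κs f)ᴴ * κs f = 1)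
    (κ : ∀ i, Fi i → Matrix (B i) (B' i) ℂ) (hκ : ∀ i, ∑ f, (κ i f)ᴴ * κ i f = 1)
    (a : ∀ i, Ans i) :
    (D.precomp κs hκs κ hκ).effect a = ∑ f, ∑ fi : ∀ i, Fi i,
      (κs f ⊗ₖ piKronecker fun i => κ i (fi i))ᴴ * D.effect a *
        (κs f ⊗ₖ piKronecker fun i => κ i (fi i)) :=
  localEffect_kraus D.share (fun i => D.M i (a i)) κs κ

end LocalMeasurement

theorem sum_conjTranspose_distribute_mul {ι S E : Type} {R B : ι → Type} [Fintype ι]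
    [DecidableEq ι] [Fintype E] [DecidableEq S] [∀ i, Fintype (R i)] [∀ i, Fintype (B i)]
    [∀ i, DecidableEq (B i)] [DecidableEq (∀ i, B i)] {V : E → Matrix (∀ i, R i) S ℂ}
    (hV : ∑ e, (V e)ᴴ * V e = 1) :
    ∑ e, (distribute B (V e))ᴴ * distribute B (V e) = 1 := by
  simp only [distribute, Matrix.conjTranspose_submatrix, Matrix.submatrix_mul_equiv,
    Matrix.conjTranspose_kronecker, ← Matrix.mul_kronecker_mul,
    Matrix.conjTranspose_one, piKronecker_one, Matrix.mul_one, Matrix.submatrix_id_id,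
    sum_kronecker, hV, Matrix.one_kronecker_one]

theorem localEffect_handOver {ι S S' E T : Type} {R B B' K Y : ι → Type} [Fintype ι]
    [DecidableEq ι] [Fintype E] [Fintype T] [DecidableEq T] [∀ i, Fintype (R i)]
    [∀ i, Fintype (B i)] [∀ i, DecidableEq (B i)] [∀ i, Fintype (B' i)]
    [∀ i, DecidableEq (B' i)] [∀ i, Fintype (K i)] [∀ i, DecidableEq (K i)]
    [∀ i, DecidableEq (Y i)]
    (V : E → Matrix (∀ i, R i) S ℂ) (M : ∀ i, Matrix (R i × B i) (R i × B i) ℂ)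
    (σ : S' → T × S × ∀ i, K i) (β : ∀ i, K i × B' i → B i × Y i) (s s' : S') (b b' : ∀ i, B' i) :
    localEffect (fun e : E × T => .of fun rk s =>
        if (σ s).1 = e.2 then distribute K (V e.1) rk (σ s).2 else 0)
      (fun i => (M i ⊗ₖ (1 : Matrix (Y i) (Y i) ℂ)).submatrix
        (fun q : (R i × K i) × B' i => ((q.1.1, (β i (q.1.2, q.2)).1), (β i (q.1.2, q.2)).2))
        (fun q : (R i × K i) × B' i => ((q.1.1, (β i (q.1.2, q.2)).1), (β i (q.1.2, q.2)).2)))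
      (s, b) (s', b') =
    if (σ s).1 = (σ s').1 ∧
        (fun i => (β i ((σ s).2.2 i, b i)).2) = (fun i => (β i ((σ s').2.2 i, b' i)).2) then
      localEffect V M ((σ s).2.1, fun i => (β i ((σ s).2.2 i, b i)).1)
        ((σ s').2.1, fun i => (β i ((σ s').2.2 i, b' i)).1)
    else 0 := by
  classical
  rcases hσ : σ s with ⟨t, u, k⟩
  rcases hσ' : σ s' with ⟨t', u', k'⟩
  simp only [localEffect_apply, Matrix.of_apply, Fintype.sum_prod_type, hσ, hσ', sum_pi_prod,
    distribute_apply, Matrix.submatrix_apply, Matrix.kroneckerMap_apply, Finset.prod_mul_distrib,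
    ← piKronecker_apply (fun i => (1 : Matrix (Y i) (Y i) ℂ)), piKronecker_one, apply_ite star,
    star_zero, mul_ite, ite_mul, mul_zero, zero_mul, mul_one]
  simp only [Finset.sum_ite_irrel, Finset.sum_const_zero, Finset.sum_ite_eq, Finset.sum_ite_eq',
    Finset.mem_univ, if_true, Matrix.one_apply, mul_ite, ite_mul, mul_one, mul_zero, zero_mul,
    ite_and]

theorem sum_submatrix {α κ l m n o : Type*} [AddCommMonoid α] (s : Finset κ)
    (M : κ → Matrix m n α) (f : l → m) (g : o → n) :
    ∑ e ∈ s, (M e).submatrix f g = (∑ e ∈ s, M e).submatrix f g := by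
  ext
  simp only [Matrix.sum_apply, Matrix.submatrix_apply]

theorem sum_conjTranspose_submatrix_mul {α E m m' n n' : Type*} [Semiring α] [StarRing α]
    [Fintype E] [Fintype m] [Fintype m'] [DecidableEq n] [DecidableEq n'] {M : E → Matrix m n α}
    (hM : ∑ e, (M e)ᴴ * M e = 1) (f : m' ≃ m) (g : n' ≃ n) :
    ∑ e, ((M e).submatrix f g)ᴴ * (M e).submatrix f g = 1 := by
  simp only [Matrix.conjTranspose_submatrix, Matrix.submatrix_mul_equiv]
  rw [sum_submatrix, hM, Matrix.submatrix_one_equiv]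

theorem sum_conjTranspose_piKronecker_mul {ι α : Type*} {m n E : ι → Type*} [Fintype ι]
    [DecidableEq ι] [CommSemiring α] [StarRing α] [∀ i, Fintype (m i)] [∀ i, Fintype (E i)]
    [∀ i, DecidableEq (n i)] [DecidableEq (∀ i, n i)] {M : ∀ i, E i → Matrix (m i) (n i) α}
    (hM : ∀ i, ∑ e, (M i e)ᴴ * M i e = 1) :
    ∑ e : ∀ i, E i, (piKronecker fun i => M i (e i))ᴴ * piKronecker (fun i => M i (e i)) = 1 := by
  simp only [conjTranspose_piKronecker, piKronecker_mul_piKronecker]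
  rw [sum_piKronecker fun i e => (M i e)ᴴ * M i e]
  simp only [hM, piKronecker_one]

/-- A family of values, cut into the fibres of `f`. -/
def fiberPiEquiv {W C : Type*} (f : W → C) (B : W → Type*) :
    (∀ w, B w) ≃ ∀ c, ∀ w : {w // f w = c}, B w where
  toFun b _ w := b w
  invFun b w := b (f w) ⟨w, rfl⟩
  left_inv _ := rfl
  right_inv b := by
    ext c ⟨w, rfl⟩
    rfl

/-- The values on the fibres of `f` over a subtype. -/
def subtypeFiberPiEquiv {W G : Type*} (f : W → G) (p : G → Prop) (B : W → Type*) :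
    (∀ w : {w // p (f w)}, B w) ≃ ∀ g : {g // p g}, ∀ w : {w // f w = g}, B w where
  toFun b g w := b ⟨w, (congrArg p w.2).mpr g.2⟩
  invFun b w := b ⟨f w, w.2⟩ ⟨w, rfl⟩
  left_inv _ := rfl
  right_inv b := by
    ext ⟨g, hg⟩ ⟨w, hw⟩
    cases hw
    rfl

/-- Registers are classified as discarded (`none`), shared (`some none`) or belonging to a party `i`
(`some (some i)`); this cuts a family of values accordingly. -/
def classEquiv {W ι : Type*} (f : W → Option (Option ι)) (B : W → Type*) :
    (∀ w, B w) ≃ (∀ w : {w // f w = none}, B w) × (∀ w : {w // f w = some none}, B w) ×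
      ∀ i, ∀ w : {w // f w = some (some i)}, B w :=
  (fiberPiEquiv f B).trans (Equiv.piOptionEquivProd.trans
    ((Equiv.refl _).prodCongr Equiv.piOptionEquivProd))

theorem piKronecker_option {ι α : Type*} [Fintype ι] [CommMonoid α] {m n : Option ι → Type*}
    (M : ∀ o, Matrix (m o) (n o) α) :
    piKronecker M = (M none ⊗ₖ piKronecker fun i => M (some i)).submatrix
      Equiv.piOptionEquivProd Equiv.piOptionEquivProd := by
  ext c d
  exact Fintype.prod_option fun o => M o (c o) (d o)

namespace Circuit

variable {N : ℕ} {A : Type} [Fintype A] [DecidableEq A] {ι : Type}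

/-- A tensor product of Kraus operators of the gates of layer `t` whose class is `c`, for a
classification `γ` of the gates. -/
noncomputable def classKraus (C : Circuit N A) (t : ℕ) {Γ : Type} [DecidableEq Γ]
    (γ : Fin (C.gates t) → Γ) (c : Γ) (e : ∀ g : {g // γ g = c}, Fin (C.rank t g)) :
    Matrix ({w // γ (C.writes t w) = c} → A) ({w // γ (C.reads t w) = c} → A) ℂ :=
  (piKronecker fun g : {g // γ g = c} => C.kraus t g (e g)).submatrix
    (subtypeFiberPiEquiv (C.writes t) (γ · = c) fun _ => A)
    (subtypeFiberPiEquiv (C.reads t) (γ · = c) fun _ => A)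

theorem sum_conjTranspose_classKraus_mul (C : Circuit N A) (t : ℕ) {Γ : Type} [DecidableEq Γ]
    (γ : Fin (C.gates t) → Γ) (c : Γ) :
    ∑ e, (C.classKraus t γ c e)ᴴ * C.classKraus t γ c e = 1 :=
  sum_conjTranspose_submatrix_mul
    (sum_conjTranspose_piKronecker_mul fun g : {g // γ g = c} => C.kraus_complete t g) _ _

theorem layerKraus_eq_submatrix_classKraus [Fintype ι] [DecidableEq ι] (C : Circuit N A) (t : ℕ)
    (γ : Fin (C.gates t) → Option (Option ι)) (e : ∀ g, Fin (C.rank t g)) :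
    C.layerKraus t e = (C.classKraus t γ none (classEquiv γ _ e).1 ⊗ₖ
      (C.classKraus t γ (some none) (classEquiv γ _ e).2.1 ⊗ₖ
        piKronecker fun i => C.classKraus t γ (some (some i)) ((classEquiv γ _ e).2.2 i))).submatrix
      (classEquiv (γ ∘ C.writes t) fun _ => A) (classEquiv (γ ∘ C.reads t) fun _ => A) := by
  have h : C.layerKraus t e = (piKronecker fun c => C.classKraus t γ c fun g => e g).submatrix
      (fiberPiEquiv (γ ∘ C.writes t) fun _ => A) (fiberPiEquiv (γ ∘ C.reads t) fun _ => A) := by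
    ext y x
    exact (Fintype.prod_fiberwise γ fun g => C.kraus t g (e g) (fun w => y w) fun w => x w).symm
  rw [h, piKronecker_option, piKronecker_option]
  rfl

end Circuit

namespace LocalMeasurement

variable {ι : Type} [Fintype ι] [DecidableEq ι] {S S' T : Type} [Fintype S] [DecidableEq S]
  [Fintype S'] [DecidableEq S'] [Fintype T] [DecidableEq T] {B B' K Y Ans : ι → Type}
  [∀ i, Fintype (B i)] [∀ i, DecidableEq (B i)] [∀ i, Fintype (B' i)] [∀ i, DecidableEq (B' i)]
  [∀ i, Fintype (K i)] [∀ i, DecidableEq (K i)] [∀ i, Fintype (Y i)] [∀ i, DecidableEq (Y i)]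
  [∀ i, Fintype (Ans i)]

/-- The local measurement in which the register held by nobody is first split into a part that is
traced out, a part that is distributed as in `D` and parts that are handed over to the parties;
party `i` then traces out the part `Y i` of what it holds and applies its measurement of `D`. -/
def handOver (D : LocalMeasurement S B Ans) (σ : S' → T × S × ∀ i, K i) (hσ : σ.Injective)
    (β : ∀ i, K i × B' i → B i × Y i) (hβ : ∀ i, (β i).Injective) :
    LocalMeasurement S' B' Ans where
  R i := D.R i × K i
  Env := D.Env × T
  share e := .of fun rk s => if (σ s).1 = e.2 then distribute K (D.share e.1) rk (σ s).2 else 0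
  share_complete := by
    have h := sum_conjTranspose_distribute_mul (B := K) D.share_complete
    ext s s'
    have hs := congrFun₂ h (σ s).2 (σ s').2
    simp only [Matrix.sum_apply, Matrix.mul_apply, Matrix.conjTranspose_apply] at hs
    simp only [Matrix.sum_apply, Matrix.mul_apply, Matrix.conjTranspose_apply, Matrix.of_apply,
      Fintype.sum_prod_type, apply_ite star, star_zero, mul_ite, ite_mul, mul_zero, zero_mul,
      Finset.sum_ite_irrel, Finset.sum_const_zero, Finset.sum_ite_eq, Finset.mem_univ, if_true, hs,
      Matrix.one_apply, ← hσ.eq_iff]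
    simp only [Prod.ext_iff (x := σ s), ite_and]
  M i a := (D.M i a ⊗ₖ (1 : Matrix (Y i) (Y i) ℂ)).submatrix
    (fun q : (D.R i × K i) × B' i => ((q.1.1, (β i (q.1.2, q.2)).1), (β i (q.1.2, q.2)).2))
    (fun q : (D.R i × K i) × B' i => ((q.1.1, (β i (q.1.2, q.2)).1), (β i (q.1.2, q.2)).2))
  M_pos i a := ((D.M_pos i a).kronecker .one).submatrix _
  M_sum i := by
    have hinj : (fun q : (D.R i × K i) × B' i =>
        ((q.1.1, (β i (q.1.2, q.2)).1), (β i (q.1.2, q.2)).2)).Injective := by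
      rintro ⟨⟨r, k⟩, b⟩ ⟨⟨r', k'⟩, b'⟩ h
      simp only [Prod.mk.injEq] at h ⊢
      have := hβ i (Prod.ext h.1.2 h.2)
      simp_all
    rw [sum_submatrix, sum_kronecker, D.M_sum, Matrix.one_kronecker_one,
      Matrix.submatrix_one _ hinj]

theorem effect_handOver (D : LocalMeasurement S B Ans) (σ : S' → T × S × ∀ i, K i)
    (hσ : σ.Injective) (β : ∀ i, K i × B' i → B i × Y i) (hβ : ∀ i, (β i).Injective)
    (a : ∀ i, Ans i) (s s' : S') (b b' : ∀ i, B' i) :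
    (D.handOver σ hσ β hβ).effect a (s, b) (s', b') =
      if (σ s).1 = (σ s').1 ∧
          (fun i => (β i ((σ s).2.2 i, b i)).2) = (fun i => (β i ((σ s').2.2 i, b' i)).2) then
        D.effect a ((σ s).2.1, fun i => (β i ((σ s).2.2 i, b i)).1)
          ((σ s').2.1, fun i => (β i ((σ s').2.2 i, b' i)).1)
      else 0 :=
  localEffect_handOver D.share (fun i => D.M i (a i)) σ β s s' b b'

/-- The register held by nobody is measured in the computational basis and its value is sent to all
parties; each party measures its register in the computational basis and answers by `dec i`. -/
def ofDecode [∀ i, DecidableEq (Ans i)] (dec : ∀ i, S × B i → Ans i) :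
    LocalMeasurement S B Ans where
  R _ := S
  Env := S
  share e := .of fun r s => if s = e ∧ r = fun _ => s then 1 else 0
  share_complete := by
    ext s s'
    simp only [Matrix.sum_apply, Matrix.mul_apply, Matrix.conjTranspose_apply, Matrix.of_apply,
      apply_ite star, star_zero, star_one, mul_ite, mul_one, mul_zero, ite_and,
      Finset.sum_ite_irrel, Finset.sum_const_zero, Finset.sum_ite_eq, Finset.sum_ite_eq',
      Finset.mem_univ, if_true, Matrix.one_apply]
    split_ifs with h h' <;> simp_all
  M i a := Matrix.diagonal fun q => if dec i q = a then 1 else 0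
  M_pos i a := Matrix.PosSemidef.diagonal fun q => by dsimp only [Pi.zero_apply]; split_ifs <;> simp
  M_sum i := by
    ext q q'
    rw [Matrix.sum_apply]
    simp [Matrix.diagonal_apply, Matrix.one_apply, Finset.sum_ite_irrel]

theorem effect_ofDecode [∀ i, DecidableEq (Ans i)] (dec : ∀ i, S × B i → Ans i) (a : ∀ i, Ans i)
    (s s' : S) (b b' : ∀ i, B i) :
    (ofDecode dec).effect a (s, b) (s', b') =
      if (s, b) = (s', b') ∧ ∀ i, dec i (s, b i) = a i then 1 else 0 := by
  simp only [effect, localEffect_apply, ofDecode, Matrix.of_apply, Matrix.diagonal_apply,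
    ite_and, apply_ite star, star_zero, star_one, mul_ite, ite_mul, mul_one, one_mul, mul_zero,
    zero_mul, Finset.sum_ite_irrel, Finset.sum_const_zero, Finset.sum_ite_eq, Finset.sum_ite_eq',
    Finset.mem_univ, if_true]
  obtain rfl | hs := eq_or_ne s s'
  · simp only [if_true, Prod.mk.injEq, true_and, Finset.prod_ite_zero, Finset.prod_const_one,
      Finset.mem_univ, true_imp_iff, funext_iff]
  · simp only [hs, if_false, Prod.mk.injEq, false_and]

/-- The strategy that prepares the registers in the basis states `s` and `b i x`, `x` being the
question to party `i`, and measures them. -/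
noncomputable def toStrategy (D : LocalMeasurement S B Ans) (s : S) {Q : ι → Type}
    (b : ∀ i, Q i → B i) : Strategy Q Ans where
  H := D.R
  ρ := ∑ e, Matrix.vecMulVec (fun r => D.share e r s) (star fun r => D.share e r s)
  ρ_pos := Matrix.posSemidef_sum _ fun e _ => Matrix.posSemidef_vecMulVec_self_star _
  ρ_trace := by
    have h := congrFun₂ D.share_complete s s
    simp only [Matrix.sum_apply, Matrix.mul_apply, Matrix.conjTranspose_apply,
      Matrix.one_apply_eq] at h
    rw [Matrix.trace_sum, ← h]
    exact Finset.sum_congr rfl fun e _ => Finset.sum_congr rfl fun r _ => mul_comm _ _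
  M i x a := (D.M i a).submatrix (fun r => (r, b i x)) fun r => (r, b i x)
  M_pos i x a := (D.M_pos i a).submatrix _
  M_sum i x := by
    rw [sum_submatrix, D.M_sum, Matrix.submatrix_one _ (Prod.mk_left_injective _)]

theorem prob_toStrategy (D : LocalMeasurement S B Ans) (s : S) {Q : ι → Type}
    (b : ∀ i, Q i → B i) (x : ∀ i, Q i) (a : ∀ i, Ans i) :
    (D.toStrategy s b).prob x a =
      (D.effect a (s, fun i => b i (x i)) (s, fun i => b i (x i))).re := by
  have hprob : (D.toStrategy s b).prob x a = (Matrix.trace ((Matrix.of fun c c' : ∀ i, D.R i =>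
      ∏ i, D.M i (a i) (c i, b i (x i)) (c' i, b i (x i))) * ∑ e,
      Matrix.vecMulVec (fun r => D.share e r s) (star fun r => D.share e r s))).re := rfl
  rw [hprob, effect, localEffect_apply, Matrix.mul_sum, Matrix.trace_sum]
  congr 1
  refine Finset.sum_congr rfl fun e _ => ?_
  rw [Matrix.mul_vecMulVec, Matrix.trace_vecMulVec, Finset.sum_comm]
  simp only [dotProduct, Matrix.mulVec, Matrix.of_apply, Pi.star_apply, Finset.sum_mul]
  exact Finset.sum_congr rfl fun r _ => Finset.sum_congr rfl fun r' _ => by ring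

end LocalMeasurement

/-- The effects `E a`, on registers `w` classified by `cls`, describe a local measurement: discarded
registers are ignored, party `i` holds the registers of class `i`, and the shared registers are
held by nobody. -/
def IsLocallyMeasured {ι W A : Type} [Fintype ι] [DecidableEq ι] [Fintype W] [DecidableEq W]
    [Fintype A] [DecidableEq A] {Ans : ι → Type} [∀ i, Fintype (Ans i)]
    (cls : W → Option (Option ι)) (E : (∀ i, Ans i) → Matrix (W → A) (W → A) ℂ) : Prop :=
  ∃ D : LocalMeasurement ({w // cls w = some none} → A)
      (fun i => {w // cls w = some (some i)} → A) Ans,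
    ∀ a, E a = ((1 : Matrix ({w // cls w = none} → A) _ ℂ) ⊗ₖ D.effect a).submatrix
      (classEquiv cls fun _ => A) (classEquiv cls fun _ => A)

theorem one_kronecker_submatrix_classEquiv_apply {ι W A : Type} [Fintype W]
    [DecidableEq A] (cls : W → Option (Option ι)) (M : Matrix
      (({w // cls w = some none} → A) × ∀ i, {w // cls w = some (some i)} → A)
      (({w // cls w = some none} → A) × ∀ i, {w // cls w = some (some i)} → A) ℂ) (c c' : W → A) :
    ((1 : Matrix ({w // cls w = none} → A) _ ℂ) ⊗ₖ M).submatrix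
      (classEquiv cls fun _ => A) (classEquiv cls fun _ => A) c c' =
      if (fun w : {w // cls w = none} => c w) = (fun w : {w // cls w = none} => c' w) then
        M (fun w => c w, fun _ w => c w) (fun w => c' w, fun _ w => c' w)
      else 0 := by
  rw [Matrix.submatrix_apply, Matrix.kroneckerMap_apply, Matrix.one_apply, ite_mul, one_mul,
    zero_mul]
  rfl

theorem eqOn_discarded_iff {ι W A : Type} {cls cls' : W → Option (Option ι)}
    (hshared : ∀ w, cls' w = some none → cls w = some none)
    (hparty : ∀ w i, cls' w = some (some i) → cls w = some none ∨ cls w = some (some i))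
    (c c' : W → A) :
    (∀ w, cls' w = none → c w = c' w) ↔ (∀ w, cls w = none → c w = c' w) ∧
      (∀ w, cls w = some none ∧ cls' w = none → c w = c' w) ∧
        ∀ i w, cls w = some (some i) ∧ cls' w = none → c w = c' w := by
  refine ⟨fun h => ⟨fun w hw => h w ?_, fun w hw => h w hw.2, fun i w hw => h w hw.2⟩,
    fun ⟨hd, hs, hp⟩ w hw' => ?_⟩
  · match hw' : cls' w with
    | none => rfl
    | some none => exact absurd (hshared w hw') (by simp [hw])
    | some (some i) => simpa [hw] using hparty w i hw'
  · match hw : cls w with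
    | none => exact hd w hw
    | some none => exact hs w ⟨hw, hw'⟩
    | some (some i) => exact hp i w ⟨hw, hw'⟩

namespace IsLocallyMeasured

variable {ι W A : Type} [Fintype ι] [DecidableEq ι] [Fintype W] [DecidableEq W] [Fintype A]
  [DecidableEq A] {Ans : ι → Type} [∀ i, Fintype (Ans i)] {cls cls' : W → Option (Option ι)}
  {E : (∀ i, Ans i) → Matrix (W → A) (W → A) ℂ}

theorem of_decode [∀ i, DecidableEq (Ans i)] (dec : ∀ i, (W → A) → Ans i)
    (hdec : ∀ i c c', (∀ w, cls w = some none ∨ cls w = some (some i) → c w = c' w) →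
      dec i c = dec i c') (c₀ : W → A) :
    IsLocallyMeasured cls fun a =>
      Matrix.diagonal fun c => if ∀ i, dec i c = a i then (1 : ℂ) else 0 := by
  let merge (i : ι) (sb : ({w // cls w = some none} → A) × ({w // cls w = some (some i)} → A))
      (w : W) : A :=
    if h : cls w = some none then sb.1 ⟨w, h⟩
    else if h : cls w = some (some i) then sb.2 ⟨w, h⟩ else c₀ w
  refine ⟨.ofDecode fun i sb => dec i (merge i sb), fun a => ?_⟩
  have hmerge : ∀ c i, dec i (merge i (fun w => c w, fun w => c w)) = dec i c := fun c i =>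
    hdec i _ _ fun w hw => by
      rcases hw with hw | hw <;> simp [merge, hw]
  ext c c'
  have hc : c = c' ↔ (fun w : {w // cls w = none} => c w) = (fun w : {w // cls w = none} => c' w) ∧
      ((fun w : {w // cls w = some none} => c w,
        fun (i : ι) (w : {w // cls w = some (some i)}) => c w) : _ × _) =
      (fun w : {w // cls w = some none} => c' w,
        fun (i : ι) (w : {w // cls w = some (some i)}) => c' w) := by
    rw [← (classEquiv cls fun _ => A).injective.eq_iff, Prod.ext_iff]
    rfl
  rw [one_kronecker_submatrix_classEquiv_apply, LocalMeasurement.effect_ofDecode]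
  refine (Matrix.diagonal_apply ..).trans ?_
  simp only [hmerge, hc, ite_and]

theorem reclassify (hE : IsLocallyMeasured cls' E)
    (hshared : ∀ w, cls' w = some none → cls w = some none)
    (hparty : ∀ w i, cls' w = some (some i) → cls w = some none ∨ cls w = some (some i)) :
    IsLocallyMeasured cls E := by
  obtain ⟨D, hD⟩ := hE
  let σ (s : {w // cls w = some none} → A) :
      ({w // cls w = some none ∧ cls' w = none} → A) × ({w // cls' w = some none} → A) ×
        ∀ i, {w // cls w = some none ∧ cls' w = some (some i)} → A :=
    (fun w => s ⟨w, w.2.1⟩, fun w => s ⟨w, hshared w w.2⟩, fun _ w => s ⟨w, w.2.1⟩)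
  let β (i : ι) (kb : ({w // cls w = some none ∧ cls' w = some (some i)} → A) ×
      ({w // cls w = some (some i)} → A)) : ({w // cls' w = some (some i)} → A) ×
        ({w // cls w = some (some i) ∧ cls' w = none} → A) :=
    (fun w => if h : cls w = some none then kb.1 ⟨w, h, w.2⟩
      else kb.2 ⟨w, (hparty w i w.2).resolve_left h⟩, fun w => kb.2 ⟨w, w.2.1⟩)
  have hσ : σ.Injective := fun s s' h => by
    obtain ⟨hT, hS, hK⟩ : _ ∧ _ ∧ _ := by
      simpa only [σ, Prod.mk.injEq, funext_iff, Subtype.forall] using h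
    ext ⟨w, hw⟩
    match hw' : cls' w with
    | none => exact hT w ⟨hw, hw'⟩
    | some none => exact hS w hw'
    | some (some i) => exact hK i w ⟨hw, hw'⟩
  have hβ : ∀ i, (β i).Injective := fun i kb kb' h => by
    obtain ⟨hB, hY⟩ : _ ∧ _ := by simpa only [β, Prod.mk.injEq, funext_iff, Subtype.forall] using h
    ext ⟨w, hw⟩
    · have := hB w hw.2
      rwa [dif_pos hw.1, dif_pos hw.1] at this
    · match hw' : cls' w with
      | none => exact hY w ⟨hw, hw'⟩
      | some none => exact absurd (hshared w hw') (by simp [hw])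
      | some (some j) =>
        obtain rfl : i = j := by simpa [hw] using hparty w j hw'
        have := hB w hw'
        rwa [dif_neg (by simp [hw]), dif_neg (by simp [hw])] at this
  refine ⟨D.handOver σ hσ β hβ, fun a => ?_⟩
  ext c c'
  rw [hD, one_kronecker_submatrix_classEquiv_apply, one_kronecker_submatrix_classEquiv_apply,
    LocalMeasurement.effect_handOver, ← ite_and]
  simp only [σ, β, dite_eq_ite, ite_self]
  refine if_congr ?_ rfl rfl
  simp only [funext_iff, Subtype.forall]
  exact eqOn_discarded_iff hshared hparty c c'

theorem exists_strategy (hE : IsLocallyMeasured cls E) {Q : ι → Type} (c : (∀ i, Q i) → W → A)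
    (x₀ : ∀ i, Q i) (hshared : ∀ w, cls w = some none → ∀ x, c x w = c x₀ w)
    (hparty : ∀ w i, cls w = some (some i) → ∀ x x', x i = x' i → c x w = c x' w) :
    ∃ S : Strategy Q Ans, ∀ x a, S.prob x a = (E a (c x) (c x)).re := by
  obtain ⟨D, hD⟩ := hE
  refine ⟨D.toStrategy (fun w => c x₀ w) fun i q w => c (Function.update x₀ i q) w, fun x a => ?_⟩
  have hb : ∀ i, ∀ w : {w // cls w = some (some i)}, c (Function.update x₀ i (x i)) w = c x w :=
    fun i w => hparty w i w.2 _ _ (Function.update_self ..)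
  rw [D.prob_toStrategy, hD, one_kronecker_submatrix_classEquiv_apply, if_pos rfl]
  have hs : ∀ w : {w // cls w = some none}, c x₀ w = c x w := fun w => (hshared w w.2 x).symm
  simp only [hb, hs]

theorem conj_layerKraus {N : ℕ} (C : Circuit N A) (t : ℕ)
    (γ : Fin (C.gates t) → Option (Option ι))
    {E : (∀ i, Ans i) → Matrix (Fin (C.width (t + 1)) → A) (Fin (C.width (t + 1)) → A) ℂ}
    (hE : IsLocallyMeasured (γ ∘ C.writes t) E) :
    IsLocallyMeasured (γ ∘ C.reads t) fun a =>
      ∑ e, (C.layerKraus t e)ᴴ * E a * C.layerKraus t e := by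
  obtain ⟨D, hD⟩ := hE
  refine ⟨D.precomp (C.classKraus t γ (some none)) (C.sum_conjTranspose_classKraus_mul t γ _)
    (fun i => C.classKraus t γ (some (some i)))
    fun i => C.sum_conjTranspose_classKraus_mul t γ _, fun a => ?_⟩
  refine ((classEquiv γ _).symm.sum_comp _).symm.trans ?_
  rw [LocalMeasurement.effect_precomp, Fintype.sum_prod_type_right, Fintype.sum_prod_type]
  simp only [hD, C.layerKraus_eq_submatrix_classKraus t γ, Equiv.apply_symm_apply,
    Matrix.conjTranspose_submatrix, Matrix.submatrix_mul_equiv,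
    Matrix.conjTranspose_kronecker _ (_ ⊗ₖ _), ← Matrix.mul_kronecker_mul, Matrix.mul_one,
    sum_submatrix, sum_kronecker, C.sum_conjTranspose_classKraus_mul t γ none, kronecker_sum]

end IsLocallyMeasured

end LocalMeasurement

namespace Circuit

variable {N : ℕ} {A : Type} [Fintype A] [DecidableEq A] {ι : Type}

/-- The labels `i`, attached to input vertices by `I`, on which the wire `w` of layer `t`
depends. -/
def wireReach (C : Circuit N A) (I : Grid N → Set ι) : ∀ t, Fin (C.width t) → Set ι
  | 0 => fun w => {i | ∃ u, C.source w = Sum.inl u ∧ i ∈ I u}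
  | t + 1 => fun w => {i | ∃ w', C.reads t w' = C.writes t w ∧ i ∈ C.wireReach I t w'}

/-- The labels on which the gate `g` of layer `t` depends. -/
def gateReach (C : Circuit N A) (I : Grid N → Set ι) (t : ℕ) (g : Fin (C.gates t)) : Set ι :=
  {i | ∃ w, C.reads t w = g ∧ i ∈ C.wireReach I t w}

theorem exists_path_of_mem_gateReach (C : Circuit N A) (I : Grid N → Set ι) {i : ι} :
    ∀ (t : ℕ) (g : Fin (C.gates t)), t < C.depth → i ∈ C.gateReach I t g →
      ∃ u, i ∈ I u ∧ Relation.ReflTransGen C.Edge (.input u) (.gate t g)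
  | 0, g, ht, ⟨w, hw, u, hu, hi⟩ => by
    subst hw
    exact ⟨u, hi, .single (.inputGate u w ht hu)⟩
  | t + 1, g, ht, ⟨w, hw, hi⟩ => by
    subst hw
    obtain ⟨u, hu, hpath⟩ := exists_path_of_mem_gateReach C I t (C.writes t w) (by omega) hi
    exact ⟨u, hu, hpath.tail (.gateGate t w ht)⟩

theorem exists_mem_backwardLightcone (C : Circuit N A) (I : Grid N → Set ι) {i : ι} (v : Grid N) :
    ∀ (t : ℕ) (w : Fin (C.width t)), t = C.depth → (C.target v : ℕ) = w → i ∈ C.wireReach I t w →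
      ∃ u, i ∈ I u ∧ u ∈ C.backwardLightcone (.output v)
  | 0, w, ht, hw, ⟨u, hu, hi⟩ => ⟨u, hi, .single (.inputOutput u w v ht.symm hw hu)⟩
  | t + 1, w, ht, hw, hi => by
    obtain ⟨u, hu, hpath⟩ := C.exists_path_of_mem_gateReach I t (C.writes t w) (by omega) hi
    exact ⟨u, hu, hpath.tail (.gateOutput t w v ht hw)⟩

open Classical in
/-- Wires that depend on no label are shared, wires that depend on a single label belong to it, all
other wires are discarded. -/
noncomputable def reachClass (S : Set ι) : Option (Option ι) :=
  if S = ∅ then some none else if h : ∃ i, S = {i} then some (some h.choose) else none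

theorem reachClass_eq_shared {S : Set ι} : reachClass S = some none ↔ S = ∅ := by
  unfold reachClass
  split_ifs with hempty <;> simp [hempty]

theorem reachClass_eq_party {S : Set ι} {i : ι} : reachClass S = some (some i) ↔ S = {i} := by
  unfold reachClass
  split_ifs with hempty hsingle
  · simp [hempty]
  · have := hsingle.choose_spec
    constructor
    · intro h
      rw [← Option.some.inj (Option.some.inj h)]
      exact this
    · intro h
      rw [Set.singleton_injective (this.symm.trans h)]
  · simp only [false_iff]
    exact fun h => hsingle ⟨i, h⟩

theorem reachClass_mono {S S' : Set ι} (h : S ⊆ S') (hS' : reachClass S' ≠ none) :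
    reachClass S = some none ∨ reachClass S = reachClass S' := by
  rcases h' : reachClass S' with _ | _ | i
  · exact absurd h' hS'
  · rw [reachClass_eq_shared] at h' ⊢
    exact .inl (Set.subset_eq_empty h h')
  · rw [reachClass_eq_party] at h'
    rw [reachClass_eq_shared, reachClass_eq_party]
    exact Set.subset_singleton_iff_eq.mp (h' ▸ h)

variable [Fintype ι] [DecidableEq ι]

theorem exists_strategy_trace_state_mul (C : Circuit N A) {Q Ans : ι → Type} [∀ i, Fintype (Ans i)]
    (input : (∀ i, Q i) → Grid N → A) (I : Grid N → Set ι)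
    (hI : ∀ u x x', (∀ i ∈ I u, x i = x' i) → input x u = input x' u) (x₀ : ∀ i, Q i) :
    ∀ (t : ℕ) {E : (∀ i, Ans i) → Matrix (Fin (C.width t) → A) (Fin (C.width t) → A) ℂ},
      IsLocallyMeasured (fun w => reachClass (C.wireReach I t w)) E →
      ∃ S : Strategy Q Ans, ∀ x a, S.prob x a = (Matrix.trace (C.state (input x) t * E a)).re
  | 0, E, hE => by
    have hsource : ∀ w x x', (∀ i ∈ C.wireReach I 0 w, x i = x' i) →
        Sum.elim (input x) id (C.source w) = Sum.elim (input x') id (C.source w) := by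
      intro w x x' h
      rcases hs : C.source w with u | a
      · exact hI u x x' fun i hi => h i ⟨u, hs, hi⟩
      · rfl
    obtain ⟨S, hS⟩ := hE.exists_strategy (fun x w => Sum.elim (input x) id (C.source w)) x₀
      (fun w hw x => hsource w x x₀ fun i hi => by simp [reachClass_eq_shared.mp hw] at hi)
      fun w i hw x x' hx => hsource w x x' fun i' hi' => by
        rw [reachClass_eq_party.mp hw] at hi'
        rwa [Set.mem_singleton_iff.mp hi']
    exact ⟨S, fun x a => by rw [hS, state, Matrix.trace_single_mul, one_smul]⟩
  | t + 1, E, hE => by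
    have hsub : ∀ w, C.wireReach I t w ⊆ C.gateReach I t (C.reads t w) := fun w i hi => ⟨w, rfl, hi⟩
    obtain ⟨S, hS⟩ := C.exists_strategy_trace_state_mul input I hI x₀ t
      ((IsLocallyMeasured.conj_layerKraus C t (fun g => reachClass (C.gateReach I t g))
        hE).reclassify
        (fun w hw => (reachClass_mono (hsub w) (ne_of_eq_of_ne hw nofun)).elim id (·.trans hw))
        fun w i hw => (reachClass_mono (hsub w) (ne_of_eq_of_ne hw nofun)).imp_right (·.trans hw))
    refine ⟨S, fun x a => ?_⟩
    simp only [hS, state, Matrix.mul_sum, Matrix.sum_mul, Matrix.trace_sum, Matrix.mul_assoc,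
      Matrix.trace_mul_comm (C.layerKraus t _)]

theorem state_posSemidef (C : Circuit N A) (input : Grid N → A) (t : ℕ) :
    (C.state input t).PosSemidef := by
  induction t with
  | zero =>
    rw [state, ← Matrix.diagonal_single]
    refine Matrix.PosSemidef.diagonal fun c => ?_
    rw [Pi.single_apply]
    split_ifs <;> simp
  | succ t ih =>
    rw [state]
    exact Matrix.posSemidef_sum _ fun e _ => ih.mul_mul_conjTranspose_same _

theorem outProb_nonneg (C : Circuit N A) (input y : Grid N → A) : 0 ≤ C.outProb input y :=
  Finset.sum_nonneg fun _ _ =>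
    (Complex.nonneg_iff.mp (C.state_posSemidef input C.depth).diag_nonneg).1

theorem sum_outProb_eq_re_trace [NeZero N] (C : Circuit N A) (input : Grid N → A)
    (p : (Grid N → A) → Prop) [DecidablePred p] :
    ∑ y with p y, C.outProb input y = (Matrix.trace (C.state input C.depth *
      Matrix.diagonal fun c => if p (c ∘ C.target) then 1 else 0)).re := by
  simp only [outProb, Matrix.trace, Matrix.diag_apply, Matrix.mul_diagonal, mul_ite, mul_one,
    mul_zero, Complex.re_sum, ← Finset.sum_filter]
  rw [← Finset.sum_fiberwise_of_maps_to (t := Finset.univ.filter p)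
    (g := (· ∘ C.target)) fun c hc => by simpa using hc]
  refine Finset.sum_congr rfl fun y hy => Finset.sum_congr (Finset.ext fun c => ?_) fun _ _ => rfl
  simp only [Finset.mem_filter, Finset.mem_univ, true_and, funext_iff] at hy ⊢
  refine ⟨fun h => ⟨?_, h⟩, And.right⟩
  rwa [show c ∘ C.target = y from funext h]

theorem exists_strategy [NeZero N] (C : Circuit N A) {Q Ans : ι → Type} [∀ i, Fintype (Ans i)]
    [∀ i, DecidableEq (Ans i)] (input : (∀ i, Q i) → Grid N → A) (I : Grid N → Set ι)
    (hI : ∀ u x x', (∀ i ∈ I u, x i = x' i) → input x u = input x' u) (x₀ : ∀ i, Q i)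
    (region : ι → Set (Grid N)) (dec : ∀ i, (Grid N → A) → Ans i)
    (hdec : ∀ i y y', (∀ v ∈ region i, y v = y' v) → dec i y = dec i y')
    (hcone : ∀ i, ∀ v ∈ region i, ∀ u ∈ C.backwardLightcone (.output v), ∀ i' ∈ I u, i' = i) :
    ∃ S : Strategy Q Ans, ∀ x a,
      S.prob x a = ∑ y with ∀ i, dec i y = a i, C.outProb (input x) y := by
  have hregion : ∀ i, ∀ v ∈ region i, C.wireReach I C.depth (C.target v) ⊆ {i} :=
    fun i v hv i' hi' =>
      have ⟨u, hu, huv⟩ := C.exists_mem_backwardLightcone I v _ _ rfl rfl hi'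
      hcone i v hv u huv i' hu
  have hE : IsLocallyMeasured (fun w => reachClass (C.wireReach I C.depth w)) _ :=
    .of_decode (fun i c => dec i (c ∘ C.target)) (fun i c c' h =>
      hdec i _ _ fun v hv => h _ <| by
        rw [reachClass_eq_shared, reachClass_eq_party]
        exact Set.subset_singleton_iff_eq.mp (hregion i v hv)) fun _ => input x₀ 0
  obtain ⟨S, hS⟩ := C.exists_strategy_trace_state_mul input I hI x₀ C.depth hE
  exact ⟨S, fun x a => by rw [hS, C.sum_outProb_eq_re_trace _ fun y => ∀ i, dec i y = a i]⟩

end Circuit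

/-! ### Pauli operators and honest measurements -/

section RootPow

variable {d : ℕ} [NeZero d]

theorem rootPow_add (a b : ZMod d) : rootPow d (a + b) = rootPow d a * rootPow d b :=
  AddChar.map_add_eq_mul _ _ _

theorem rootPow_mul_natCast (a : ZMod d) (t : ℕ) : rootPow d (a * t) = rootPow d a ^ t := by
  rw [mul_comm, ← nsmul_eq_mul]
  exact AddChar.map_nsmul_eq_pow _ _ _

theorem rootPow_sum {α : Type*} (s : Finset α) (f : α → ZMod d) :
    rootPow d (∑ i ∈ s, f i) = ∏ i ∈ s, rootPow d (f i) :=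
  map_prod (ZMod.stdAddChar (N := d)).toMonoidHom (fun i => Multiplicative.ofAdd (f i)) s

theorem conj_rootPow (a : ZMod d) : starRingEnd ℂ (rootPow d a) = rootPow d (-a) :=
  (AddChar.map_neg_eq_conj _ _).symm

theorem rootPow_ne_zero (a : ZMod d) : rootPow d a ≠ 0 :=
  ((ZMod.stdAddChar (N := d)).val_isUnit a).ne_zero

variable {κ : Type} [Fintype κ] [DecidableEq κ]

theorem mul_pauli_apply {n : Type*} (M : Matrix n (κ → ZMod d) ℂ) (q : PauliLabel d κ) (f : n)
    (g : κ → ZMod d) :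
    (M * pauli q) f g = M f (fun i => g i + (q i).1) * rootPow d (∑ i, (q i).2 * g i) := by
  simp only [Matrix.mul_apply, pauli_apply, mul_ite, mul_zero, Finset.sum_ite_eq',
    Finset.mem_univ, if_true]

theorem smul_pauli_pow_mul_pauli (z : ℂ) (q r : PauliLabel d κ) (t : ℕ) :
    (z • pauli q) ^ t * pauli r = rootPow d (cor r q * t) • (pauli r * (z • pauli q) ^ t) := by
  have h : SemiconjBy (pauli r) (rootPow d (cor r q) • z • pauli q) (z • pauli q) := by
    rw [SemiconjBy, Matrix.smul_mul, pauli_commutator, Matrix.mul_smul, Matrix.mul_smul, smul_comm]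
  rw [← (h.pow_right t).eq, smul_pow, Matrix.mul_smul, rootPow_mul_natCast]

end RootPow

theorem semiconjBy_list_ofFn_prod {R : Type*} [Monoid R] {b : R} :
    ∀ {m : ℕ} {f g : Fin m → R}, (∀ s, SemiconjBy b (f s) (g s)) →
      SemiconjBy b (List.ofFn f).prod (List.ofFn g).prod
  | 0, _, _, _ => by simp
  | m + 1, _, _, h => by
    simpa only [List.ofFn_succ, List.prod_cons] using
      (h 0).mul_right (semiconjBy_list_ofFn_prod fun s => h s.succ)

namespace HonestStrategy

variable {ℓ d : ℕ} [NeZero d] {κ : Fin ℓ → Type} [∀ j, Fintype (κ j)] [∀ j, DecidableEq (κ j)]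
  {m : Fin ℓ → ℕ} {G : StabilizerGame ℓ d κ m}

theorem proj_mul_pauli (S : HonestStrategy G) (j : Fin ℓ) (x : G.Question j)
    (a : Fin (m j) → ZMod d) (r : PauliLabel d (κ j)) :
    S.proj j x a * pauli r =
      pauli r * S.proj j x (fun s => a s - cor r (x s : PauliLabel d (κ j))) := by
  refine (semiconjBy_list_ofFn_prod fun s => ?_).eq.symm
  rw [SemiconjBy, Matrix.smul_mul, Matrix.mul_smul, Matrix.sum_mul, Matrix.mul_sum]
  congr 1
  refine Finset.sum_congr rfl fun t _ => ?_
  rw [Matrix.smul_mul, smul_pauli_pow_mul_pauli, smul_smul, ← rootPow_add, Matrix.mul_smul,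
    sub_mul, neg_sub, neg_add_eq_sub]

theorem sum_prod_proj_mul_eq_zero_of_not_wins (S : HonestStrategy G) (hS : S.Perfect) {x : G.Query}
    (hx : x ∈ G.dist.support) {a : ∀ j, Fin (m j) → ZMod d} (ha : ¬ G.Wins x a)
    (f : ∀ j, κ j → ZMod d) :
    ∑ g : ∀ j, κ j → ZMod d, (∏ j, S.proj j (x j) (a j) (f j) (g j)) * S.ψ g = 0 := by
  have hprob := hS x hx a ha
  rw [prob, Finset.sum_eq_zero_iff_of_nonneg fun _ _ => sq_nonneg _] at hprob
  simpa using hprob f (Finset.mem_univ f)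

theorem sum_prod_proj_mul_pauli_eq_zero_of_not_wins (S : HonestStrategy G) (hS : S.Perfect)
    {x : G.Query} (hx : x ∈ G.dist.support) (a : ∀ j, Fin (m j) → ZMod d)
    (r : ∀ j, PauliLabel d (κ j))
    (hlose : ¬ G.Wins x fun j s => a j s - cor (r j) (x j s : PauliLabel d (κ j)))
    (f : ∀ j, κ j → ZMod d) :
    ∑ g : ∀ j, κ j → ZMod d,
      (∏ j, (S.proj j (x j) (a j) * pauli (r j)) (f j) (g j)) * S.ψ g = 0 := by
  simp only [proj_mul_pauli]
  simp only [Matrix.mul_apply, Fintype.prod_sum, Finset.prod_mul_distrib, Finset.sum_mul,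
    mul_assoc]
  rw [Finset.sum_comm]
  refine Finset.sum_eq_zero fun c _ => ?_
  rw [← Finset.mul_sum, S.sum_prod_proj_mul_eq_zero_of_not_wins hS hx hlose, mul_zero]

theorem sum_prod_rootPow_mul_proj_eq_zero_of_not_wins (S : HonestStrategy G) (hS : S.Perfect)
    {x : G.Query} (hx : x ∈ G.dist.support) (a : ∀ j, Fin (m j) → ZMod d)
    (r : ∀ j, PauliLabel d (κ j))
    (hlose : ¬ G.Wins x fun j s => a j s - cor (r j) (x j s : PauliLabel d (κ j)))
    (f g : ∀ j, κ j → ZMod d) :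
    ∑ h : ∀ j, κ j → ZMod d, (∏ j, rootPow d (∑ s, (r j s).2 * h j s) *
      S.proj j (x j) (a j) (f j) (fun s => g j s + (r j s).1 + h j s)) *
        S.ψ (fun j s => g j s + h j s) = 0 := by
  have hzero := S.sum_prod_proj_mul_pauli_eq_zero_of_not_wins hS hx a r hlose f
  rw [← Equiv.sum_comp (Equiv.addLeft g)] at hzero
  have hphase : ∀ h : ∀ j, κ j → ZMod d,
      (∏ j, (S.proj j (x j) (a j) * pauli (r j)) (f j) ((g + h) j)) * S.ψ (g + h) =
        (∏ j, rootPow d (∑ s, (r j s).2 * g j s)) *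
          ((∏ j, rootPow d (∑ s, (r j s).2 * h j s) *
            S.proj j (x j) (a j) (f j) (fun s => g j s + (r j s).1 + h j s)) *
            S.ψ (fun j s => g j s + h j s)) := by
    intro h
    rw [← mul_assoc, ← Finset.prod_mul_distrib]
    congr 1
    refine Finset.prod_congr rfl fun j _ => ?_
    simp only [mul_pauli_apply, Pi.add_apply, mul_add, Finset.sum_add_distrib, rootPow_add,
      add_right_comm]
    ring
  simp only [Equiv.coe_addLeft, hphase, ← Finset.mul_sum] at hzero
  exact (mul_eq_zero.mp hzero).resolve_left <|
    Finset.prod_ne_zero_iff.mpr fun j _ => rootPow_ne_zero _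

end HonestStrategy

/-! ### Teleportation along the routes -/

theorem last_eq_zero_add_sum {G : Type*} [AddCommMonoid G] :
    ∀ {n : ℕ} {u : Fin (n + 1) → G} {w : Fin n → G}, (∀ t, u t.succ = u t.castSucc + w t) →
      u (Fin.last n) = u 0 + ∑ t, w t
  | 0, _, _, _ => by simp
  | n + 1, u, w, h => by
    have ih := last_eq_zero_add_sum (u := fun t => u t.castSucc) (w := fun t => w t.castSucc)
      fun t => by rw [← h, Fin.succ_castSucc]
    rw [Fin.sum_univ_castSucc, ← add_assoc, ← Fin.succ_last, h, ih, Fin.castSucc_zero]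

theorem sum_eq_zero_of_sum_translates {G H R : Type*} [AddGroup G] [Fintype G] [Fintype H]
    [Nonempty H] [Semiring R] [CharZero R] [NoZeroDivisors R] (T : G → R) (τ : H → G)
    (h : ∀ c, ∑ x, T (c + τ x) = 0) : ∑ c, T c = 0 := by
  have htranslate : ∀ x, ∑ c, T (c + τ x) = ∑ c, T c := fun x =>
    Equiv.sum_comp (Equiv.addRight (τ x)) T
  have hcard : (Fintype.card H : R) * ∑ c, T c = 0 := by
    rw [← nsmul_eq_mul, ← Finset.card_univ, ← Finset.sum_const,
      ← Finset.sum_congr rfl fun x _ => htranslate x, Finset.sum_comm]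
    exact Finset.sum_eq_zero fun c _ => h c
  exact (mul_eq_zero.mp hcard).resolve_left (Nat.cast_ne_zero.mpr Fintype.card_ne_zero)

namespace CircuitGame

variable {d : ℕ} [NeZero d]

theorem bellAmp_add (o : ZMod d × ZMod d) (a b h : ZMod d) :
    bellAmp o (a + h) (b + h) = rootPow d (o.2 * h) * bellAmp o a b := by
  simp only [bellAmp, add_right_comm a h, add_left_inj, mul_add, rootPow_add]
  split_ifs
  · ring
  · rw [mul_zero]

theorem eq_add_of_bellAmp_ne_zero {o : ZMod d × ZMod d} {a b : ZMod d} (h : bellAmp o a b ≠ 0) :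
    b = a + o.1 :=
  of_not_not fun hne => h (if_neg hne)

end CircuitGame

namespace Dir

theorem opp_opp (e : Dir) : e.opp.opp = e := by cases e <;> rfl

theorem move_opp_move {N : ℕ} (e : Dir) (v : Grid N) : e.opp.move (e.move v) = v := by
  cases e <;> simp [move, opp]

end Dir

namespace Wiring

variable {N r ℓ : ℕ} {P : InputPattern N r ℓ} (W : Wiring P)

theorem inDir_zero (i : Fin r) (j : Fin ℓ) : W.inDir i j 0 = W.share i j := rfl

theorem inDir_succ (i : Fin r) (j : Fin ℓ) (t : Fin (W.route i j).len) :
    W.inDir i j t.succ = ((W.route i j).dir t).opp := rfl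

/-- The group of qudits at `v` that faces `e` is used by the `j`-th route of the `i`-th star. -/
def OnRoute (i : Fin r) (j : Fin ℓ) (v : Grid N) (e : Dir) : Prop :=
  (∃ t, v = (W.route i j).pt t ∧ e = W.inDir i j t) ∨
    ∃ t : Fin (W.route i j).len, v = (W.route i j).pt t.castSucc ∧ e = (W.route i j).dir t

/-- All routes of all stars are vertex-disjoint. -/
def RoutesDisjoint : Prop :=
  ∀ i j i' j' t t', (W.route i j).pt t = (W.route i' j').pt t' → i = i' ∧ j = j'

variable {W}

theorem OnRoute.exists_pt {i : Fin r} {j : Fin ℓ} {v : Grid N} {e : Dir} (h : W.OnRoute i j v e) :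
    ∃ t, v = (W.route i j).pt t := by
  rcases h with ⟨t, h, _⟩ | ⟨t, h, _⟩
  exacts [⟨t, h⟩, ⟨_, h⟩]

theorem not_isShare_out (hW : W.RoutesDisjoint) (i : Fin r) (j : Fin ℓ)
    (t : Fin (W.route i j).len) :
    ¬ CircuitGame.IsShare W ((W.route i j).pt t.castSucc) ((W.route i j).dir t) := by
  rintro ⟨i', j', hv, he⟩
  obtain ⟨rfl, rfl⟩ := hW _ _ _ _ _ _ hv
  have := congrArg Fin.val ((W.route i j).simple hv)
  exact W.share_ne i j t this he.symm

theorem not_isShare_in (hW : W.RoutesDisjoint) (i : Fin r) (j : Fin ℓ)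
    (t : Fin (W.route i j).len) (e : Dir) :
    ¬ CircuitGame.IsShare W ((W.route i j).pt t.succ) e := by
  rintro ⟨i', j', hv, -⟩
  obtain ⟨rfl, rfl⟩ := hW _ _ _ _ _ _ hv
  exact Fin.succ_ne_zero t ((W.route i j).simple hv)

theorem OnRoute.opp (hW : W.RoutesDisjoint) {i : Fin r} {j : Fin ℓ} {v : Grid N} {e : Dir}
    (h : W.OnRoute i j v e) (hs : ¬ CircuitGame.IsShare W v e) :
    W.OnRoute i j (e.move v) e.opp ∧ ¬ CircuitGame.IsShare W (e.move v) e.opp := by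
  rcases h with ⟨t, rfl, rfl⟩ | ⟨t, rfl, rfl⟩
  · induction t using Fin.cases with
    | zero => exact absurd ⟨i, j, rfl, rfl⟩ hs
    | succ t =>
      rw [inDir_succ, (W.route i j).step, Dir.move_opp_move, Dir.opp_opp]
      exact ⟨.inr ⟨t, rfl, rfl⟩, not_isShare_out hW i j t⟩
  · rw [← (W.route i j).step]
    exact ⟨.inl ⟨t.succ, rfl, rfl⟩, not_isShare_in hW i j t _⟩

variable (W)

open Classical in
/-- The translation of the computational basis by `h j` on the groups of qudits used by the `j`-th
route of the `i`-th star, for all `j`. -/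
noncomputable def routeShift {d : ℕ} {k : Fin ℓ → ℕ} (i : Fin r)
    (h : ∀ _ : Fin ℓ, Fin (maxQudits k) → ZMod d) (q : CircuitGame.Qudit N k) : ZMod d :=
  ∑ j, if W.OnRoute i j q.1 q.2.1 then h j q.2.2 else 0

variable {W} {d : ℕ} {k : Fin ℓ → ℕ}

theorem routeShift_of_onRoute (hW : W.RoutesDisjoint) {i : Fin r} {j : Fin ℓ}
    (h : ∀ _ : Fin ℓ, Fin (maxQudits k) → ZMod d) {v : Grid N} {e : Dir}
    (hv : W.OnRoute i j v e) (s : Fin (maxQudits k)) : W.routeShift i h (v, e, s) = h j s := by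
  unfold routeShift
  rw [Finset.sum_eq_single j, if_pos hv]
  · intro j' _ hj'
    rw [if_neg]
    intro hv'
    obtain ⟨t, ht⟩ := hv.exists_pt
    obtain ⟨t', ht'⟩ := hv'.exists_pt
    exact hj' (hW _ _ _ _ _ _ (ht'.symm.trans ht)).2
  · simp

theorem routeShift_of_not {i : Fin r}
    (h : ∀ _ : Fin ℓ, Fin (maxQudits k) → ZMod d) {v : Grid N} {e : Dir}
    (hv : ∀ j, ¬ W.OnRoute i j v e) (s : Fin (maxQudits k)) : W.routeShift i h (v, e, s) = 0 :=
  Finset.sum_eq_zero fun j _ => if_neg (hv j)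

theorem routeShift_of_ne (hW : W.RoutesDisjoint) {i i' : Fin r} (hi : i' ≠ i)
    (h : ∀ _ : Fin ℓ, Fin (maxQudits k) → ZMod d) (j' : Fin ℓ) (t : Fin ((W.route i' j').len + 1))
    (e : Dir) (s : Fin (maxQudits k)) :
    W.routeShift i h ((W.route i' j').pt t, e, s) = 0 := by
  refine routeShift_of_not h (fun j hv => ?_) s
  obtain ⟨t', ht'⟩ := hv.exists_pt
  exact hi (hW _ _ _ _ _ _ ht').1

theorem OnRoute.of_opp (hW : W.RoutesDisjoint) {i : Fin r} {j : Fin ℓ} {v : Grid N} {e : Dir}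
    (h : W.OnRoute i j (e.move v) e.opp) (hs : ¬ CircuitGame.IsShare W (e.move v) e.opp) :
    W.OnRoute i j v e ∧ ¬ CircuitGame.IsShare W v e := by
  simpa only [Dir.move_opp_move, Dir.opp_opp] using h.opp hW hs

theorem routeShift_opp (hW : W.RoutesDisjoint) (i : Fin r)
    (h : ∀ _ : Fin ℓ, Fin (maxQudits k) → ZMod d) {v : Grid N} {e : Dir}
    (hs : ¬ CircuitGame.IsShare W v e) (hs' : ¬ CircuitGame.IsShare W (e.move v) e.opp)
    (s : Fin (maxQudits k)) :
    W.routeShift i h (e.move v, e.opp, s) = W.routeShift i h (v, e, s) := by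
  have hiff : ∀ j, W.OnRoute i j (e.move v) e.opp ↔ W.OnRoute i j v e := fun j =>
    ⟨fun hj => (hj.of_opp hW hs').1, fun hj => (hj.opp hW hs).1⟩
  classical
  exact Finset.sum_congr rfl fun j _ => if_congr (hiff j) rfl rfl

theorem linkAmp_add_routeShift [NeZero d] [NeZero N] (hW : W.RoutesDisjoint) (i : Fin r)
    (h : ∀ _ : Fin ℓ, Fin (maxQudits k) → ZMod d) (c : CircuitGame.Qudit N k → ZMod d)
    (v : Grid N) (e : Dir) :
    CircuitGame.linkAmp W (c + W.routeShift i h) v e = CircuitGame.linkAmp W c v e := by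
  simp only [CircuitGame.linkAmp, Pi.add_apply]
  split_ifs with hs hs' hs'
  · rfl
  · simp only [routeShift_of_not h fun _ hj => (hj.of_opp hW hs').2 hs, add_zero]
  · simp only [routeShift_of_not h fun _ hj => (hj.opp hW hs).2 hs', add_zero]
  · simp only [routeShift_opp hW i h hs hs', add_left_inj]

end Wiring

namespace CircuitGame

variable {ℓ d : ℕ} {k m : Fin ℓ → ℕ} {N r L : ℕ} {A : Type}

/-- Extension by zero from `k j` to `maxQudits k` qudits. -/
def padZero (k : Fin ℓ → ℕ) (h : ∀ j, Fin (k j) → ZMod d) (j : Fin ℓ) (s : Fin (maxQudits k)) :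
    ZMod d :=
  if hs : (s : ℕ) < k j then h j ⟨s, hs⟩ else 0

theorem padZero_castLE (h : ∀ j, Fin (k j) → ZMod d) (j : Fin ℓ) (s : Fin (k j)) :
    padZero k h j (Fin.castLE (le_maxQudits k j) s) = h j s := by
  simp [padZero]

theorem sum_mul_padZero (h : ∀ j, Fin (k j) → ZMod d) (j : Fin ℓ) (f : Fin (maxQudits k) → ZMod d) :
    ∑ s, f s * padZero k h j s = ∑ s : Fin (k j), f (Fin.castLE (le_maxQudits k j) s) * h j s := by
  rw [← Finset.sum_subset (Finset.subset_univ
    (Finset.univ.map (Fin.castLEEmb (le_maxQudits k j)))), Finset.sum_map]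
  · refine Finset.sum_congr rfl fun s _ => ?_
    rw [Fin.coe_castLEEmb, padZero_castLE]
  · intro s _ hs
    have : ¬ (s : ℕ) < k j := by
      intro h'
      exact hs (Finset.mem_map.mpr ⟨⟨s, h'⟩, Finset.mem_univ _, rfl⟩)
    simp [padZero, this]

variable [NeZero d] (𝒢 : CircuitGame ℓ d k m N r L A) {P : InputPattern N r ℓ}

theorem routeShift_of_not_measured (hW : (𝒢.wiring P).RoutesDisjoint) (i : Fin r)
    (h : ∀ j, Fin (k j) → ZMod d) {q : Qudit N k} (hq : ¬ 𝒢.Measured P q) :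
    (𝒢.wiring P).routeShift i (padZero k h) q = 0 := by
  obtain ⟨v, e, s⟩ := q
  by_cases hv : ∃ j, (𝒢.wiring P).OnRoute i j v e
  · obtain ⟨j, hv⟩ := hv
    rw [Wiring.routeShift_of_onRoute hW _ hv]
    unfold padZero
    split_ifs with hs
    · refine absurd ⟨i, j, ?_⟩ hq
      rcases hv with ⟨t, rfl, rfl⟩ | ⟨t, rfl, rfl⟩
      · induction t using Fin.lastCases with
        | last =>
          right
          exact ⟨⟨s, hs⟩, by rw [(𝒢.wiring P).route_end]; rfl⟩
        | cast t => exact .inl ⟨t, s, .inl rfl⟩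
      · exact .inl ⟨t, s, .inr rfl⟩
    · rfl
  · push Not at hv
    exact Wiring.routeShift_of_not _ hv s

end CircuitGame

namespace Wiring

variable {N r ℓ d : ℕ} {k : Fin ℓ → ℕ} {P : InputPattern N r ℓ} (W : Wiring P)

/-- The basis state `c` of the grid, restricted to the share of player `j` of the `i`-th copy of the
state of the honest strategy. -/
def shareAt (c : CircuitGame.Qudit N k → ZMod d) (i : Fin r) (j : Fin ℓ) : Fin (k j) → ZMod d :=
  fun s => c ((W.route i j).pt 0, W.share i j, Fin.castLE (le_maxQudits k j) s)

/-- The basis state `c` of the grid, restricted to the qudits at which the `j`-th route of the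
`i`-th star arrives. -/
def arrivalAt (c : CircuitGame.Qudit N k → ZMod d) (i : Fin r) (j : Fin ℓ) : Fin (k j) → ZMod d :=
  fun s => c (P.loc i j, W.inDir i j (Fin.last _), Fin.castLE (le_maxQudits k j) s)

theorem arrivalAt_add_routeShift (hW : W.RoutesDisjoint) (c : CircuitGame.Qudit N k → ZMod d)
    (h : ∀ j, Fin (k j) → ZMod d) (i : Fin r) (j : Fin ℓ) :
    W.arrivalAt (c + W.routeShift i (CircuitGame.padZero k h)) i j = W.arrivalAt c i j + h j := by
  funext s
  simp only [arrivalAt, Pi.add_apply]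
  rw [routeShift_of_onRoute hW _ (.inl ⟨Fin.last _, (W.route_end i j).symm, rfl⟩),
    CircuitGame.padZero_castLE]

theorem arrivalAt_add_routeShift_of_ne (hW : W.RoutesDisjoint)
    (c : CircuitGame.Qudit N k → ZMod d) (h : ∀ _ : Fin ℓ, Fin (maxQudits k) → ZMod d)
    {i i' : Fin r} (hi : i' ≠ i) (j : Fin ℓ) :
    W.arrivalAt (c + W.routeShift i h) i' j = W.arrivalAt c i' j := by
  funext s
  simp only [arrivalAt, Pi.add_apply, ← W.route_end, routeShift_of_ne hW hi, add_zero]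

end Wiring

namespace CircuitGame

variable {ℓ d : ℕ} {k m : Fin ℓ → ℕ} {N r L : ℕ} {A : Type}

section LinkAmp

variable [NeZero N] {P : InputPattern N r ℓ} {W : Wiring P} {c : Qudit N k → ZMod d}

theorem eq_of_linkAmp_ne_zero {v : Grid N} {e : Dir} (h : linkAmp W c v e ≠ 0)
    (hs : ¬ IsShare W v e) (hs' : ¬ IsShare W (e.move v) e.opp) (s : Fin (maxQudits k)) :
    c (v, e, s) = c (e.move v, e.opp, s) := by
  rw [linkAmp, if_neg hs, if_neg hs', Finset.prod_ne_zero_iff] at h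
  by_contra hne
  exact h s (Finset.mem_univ s) (if_neg hne)

theorem eq_of_prod_linkAmp_ne_zero (h : ∏ v, linkAmp W c v .right * linkAmp W c v .up ≠ 0)
    {v : Grid N} {e : Dir} (hs : ¬ IsShare W v e) (hs' : ¬ IsShare W (e.move v) e.opp)
    (s : Fin (maxQudits k)) : c (v, e, s) = c (e.move v, e.opp, s) := by
  have hlink := fun v => mul_ne_zero_iff.mp (Finset.prod_ne_zero_iff.mp h v (Finset.mem_univ v))
  have hback : e.opp.move (e.move v) = v := Dir.move_opp_move e v
  have of_opp : linkAmp W c (e.move v) e.opp ≠ 0 → c (v, e, s) = c (e.move v, e.opp, s) := by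
    intro hne
    simpa only [hback, Dir.opp_opp] using
      (eq_of_linkAmp_ne_zero hne hs' (by rwa [hback, Dir.opp_opp]) s).symm
  cases e with
  | right => exact eq_of_linkAmp_ne_zero (hlink v).1 hs hs' s
  | up => exact eq_of_linkAmp_ne_zero (hlink v).2 hs hs' s
  | left => exact of_opp (hlink _).1
  | down => exact of_opp (hlink _).2

end LinkAmp

variable [NeZero d] (𝒢 : CircuitGame ℓ d k m N r L A) {P : InputPattern N r ℓ}

/-- The rotation of the qudits of player `j` that results from the teleportation along the `j`-th
route of the `i`-th star, for the outcomes `o`. -/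
def routeRotation (o : 𝒢.IdealOutcome P) (i : Fin r) (j : Fin ℓ) : PauliLabel d (Fin (k j)) :=
  fun s => (∑ t, ((o i j).1 t (Fin.castLE (le_maxQudits k j) s)).1,
    -∑ t, ((o i j).1 t (Fin.castLE (le_maxQudits k j) s)).2)

/-- The amplitude, in the basis state `c`, of the product of the Bell states with labels `o` along
the `j`-th route of the `i`-th star. -/
noncomputable def routeAmp (o : 𝒢.IdealOutcome P) (c : Qudit N k → ZMod d) (i : Fin r)
    (j : Fin ℓ) : ℂ :=
  let W := 𝒢.wiring P
  ∏ t : Fin (W.route i j).len, ∏ s : Fin (maxQudits k), bellAmp ((o i j).1 t s)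
    (c ((W.route i j).pt t.castSucc, W.inDir i j t.castSucc, s))
    (c ((W.route i j).pt t.castSucc, (W.route i j).dir t, s))

open Classical in
theorem idealProj_eq (x : 𝒢.Queries) (o : 𝒢.IdealOutcome P) (c c' : Qudit N k → ZMod d) :
    𝒢.idealProj P x o c c' =
      (∏ i, ∏ j, 𝒢.routeAmp o c i j * starRingEnd ℂ (𝒢.routeAmp o c' i j) *
        𝒢.honest.proj j (x i j) (o i j).2 ((𝒢.wiring P).arrivalAt c i j)
          ((𝒢.wiring P).arrivalAt c' i j)) *
      if ∀ q, 𝒢.Measured P q ∨ c q = c' q then 1 else 0 := by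
  simp only [idealProj, routeAmp, map_prod, Finset.prod_mul_distrib]
  rfl

theorem routeAmp_add_routeShift (hW : (𝒢.wiring P).RoutesDisjoint) (o : 𝒢.IdealOutcome P)
    (c : Qudit N k → ZMod d) (h : ∀ j, Fin (k j) → ZMod d) (i : Fin r) (j : Fin ℓ) :
    𝒢.routeAmp o (c + (𝒢.wiring P).routeShift i (padZero k h)) i j =
      rootPow d (-∑ s, (𝒢.routeRotation o i j s).2 * h j s) * 𝒢.routeAmp o c i j := by
  have hphase : -∑ s, (𝒢.routeRotation o i j s).2 * h j s =
      ∑ t, ∑ s, ((o i j).1 t s).2 * padZero k h j s := by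
    rw [Finset.sum_comm]
    simp only [← Finset.sum_mul, sum_mul_padZero, routeRotation, neg_mul,
      Finset.sum_neg_distrib, neg_neg]
  have hin := fun t s => Wiring.routeShift_of_onRoute hW (padZero k h)
    (.inl ⟨t, rfl, rfl⟩ : (𝒢.wiring P).OnRoute i j _ _) s
  have hout := fun t s => Wiring.routeShift_of_onRoute hW (padZero k h)
    (.inr ⟨t, rfl, rfl⟩ : (𝒢.wiring P).OnRoute i j _ _) s
  simp only [routeAmp, Pi.add_apply, hin, hout, bellAmp_add, Finset.prod_mul_distrib, hphase,
    rootPow_sum]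

theorem routeAmp_add_routeShift_of_ne (hW : (𝒢.wiring P).RoutesDisjoint) (o : 𝒢.IdealOutcome P)
    (c : Qudit N k → ZMod d) (h : ∀ _ : Fin ℓ, Fin (maxQudits k) → ZMod d) {i i' : Fin r}
    (hi : i' ≠ i) (j : Fin ℓ) :
    𝒢.routeAmp o (c + (𝒢.wiring P).routeShift i h) i' j = 𝒢.routeAmp o c i' j := by
  simp only [routeAmp, Pi.add_apply, Wiring.routeShift_of_ne hW hi, add_zero]

theorem arrivalAt_eq_of_ne_zero [NeZero N] (hW : (𝒢.wiring P).RoutesDisjoint)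
    (o : 𝒢.IdealOutcome P) {c : Qudit N k → ZMod d}
    (hc : ∏ v, linkAmp (𝒢.wiring P) c v .right * linkAmp (𝒢.wiring P) c v .up ≠ 0)
    {i : Fin r} {j : Fin ℓ} (hb : 𝒢.routeAmp o c i j ≠ 0) :
    (𝒢.wiring P).arrivalAt c i j =
      fun s => (𝒢.wiring P).shareAt c i j s + (𝒢.routeRotation o i j s).1 := by
  funext s
  rw [Wiring.arrivalAt, ← (𝒢.wiring P).route_end]
  refine last_eq_zero_add_sum (u := fun t => c (((𝒢.wiring P).route i j).pt t,
    (𝒢.wiring P).inDir i j t, Fin.castLE (le_maxQudits k j) s)) fun t => ?_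
  have hbell := Finset.prod_ne_zero_iff.mp (Finset.prod_ne_zero_iff.mp hb t (Finset.mem_univ t))
    (Fin.castLE (le_maxQudits k j) s) (Finset.mem_univ _)
  have hnot : ¬ IsShare (𝒢.wiring P) ((((𝒢.wiring P).route i j).dir t).move
      (((𝒢.wiring P).route i j).pt t.castSucc)) (((𝒢.wiring P).route i j).dir t).opp := by
    rw [← ((𝒢.wiring P).route i j).step]
    exact Wiring.not_isShare_in hW i j t _
  rw [← eq_add_of_bellAmp_ne_zero hbell,
    eq_of_prod_linkAmp_ne_zero hc (Wiring.not_isShare_out hW i j t) hnot,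
    ((𝒢.wiring P).route i j).step, Wiring.inDir_succ]

theorem paddedψ_add_padZero (c : Fin ℓ → Fin (maxQudits k) → ZMod d) (h : ∀ j, Fin (k j) → ZMod d) :
    𝒢.paddedψ (fun j s => c j s + padZero k h j s) =
      (∏ j, ∏ s : Fin (maxQudits k), if (s : ℕ) < k j ∨ c j s = 0 then 1 else 0) *
        𝒢.honest.ψ fun j s => c j (Fin.castLE (le_maxQudits k j) s) + h j s := by
  have hzero : ∀ (j : Fin ℓ) (s : Fin (maxQudits k)),
      ((s : ℕ) < k j ∨ c j s + padZero k h j s = 0) ↔ ((s : ℕ) < k j ∨ c j s = 0) := fun j s =>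
    or_congr_right' fun hs => by rw [padZero, dif_neg hs, add_zero]
  simp only [paddedψ, hzero, padZero_castLE, mul_comm]

theorem exists_idealState_add_routeShift [NeZero N] (hW : (𝒢.wiring P).RoutesDisjoint) (i : Fin r)
    (c : Qudit N k → ZMod d) :
    ∃ K : ℂ, (K ≠ 0 → ∏ v, linkAmp (𝒢.wiring P) c v .right * linkAmp (𝒢.wiring P) c v .up ≠ 0) ∧
      ∀ h : ∀ j, Fin (k j) → ZMod d,
        𝒢.idealState P (c + (𝒢.wiring P).routeShift i (padZero k h)) =
          K * 𝒢.honest.ψ fun j s => (𝒢.wiring P).shareAt c i j s + h j s := by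
  refine ⟨(∏ v, linkAmp (𝒢.wiring P) c v .right * linkAmp (𝒢.wiring P) c v .up) *
    ((∏ i' ∈ Finset.univ.erase i, 𝒢.paddedψ fun j s =>
      c (((𝒢.wiring P).route i' j).pt 0, (𝒢.wiring P).share i' j, s)) *
      ∏ j, ∏ s : Fin (maxQudits k), if (s : ℕ) < k j ∨
        c (((𝒢.wiring P).route i j).pt 0, (𝒢.wiring P).share i j, s) = 0 then 1 else 0),
    left_ne_zero_of_mul, fun h => ?_⟩
  have hself := fun j s => Wiring.routeShift_of_onRoute hW (padZero k h)
    (.inl ⟨0, rfl, rfl⟩ : (𝒢.wiring P).OnRoute i j _ _) s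
  have hother : ∀ i' ∈ Finset.univ.erase i,
      (𝒢.paddedψ fun j s => (c + (𝒢.wiring P).routeShift i (padZero k h))
        (((𝒢.wiring P).route i' j).pt 0, (𝒢.wiring P).share i' j, s)) =
      𝒢.paddedψ fun j s => c (((𝒢.wiring P).route i' j).pt 0, (𝒢.wiring P).share i' j, s) := by
    intro i' hi'
    simp only [Pi.add_apply, Wiring.routeShift_of_ne hW (Finset.ne_of_mem_erase hi'), add_zero]
  simp only [Wiring.inDir_zero] at hself
  rw [idealState, ← Finset.prod_erase_mul _ _ (Finset.mem_univ i), Finset.prod_congr rfl hother]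
  simp only [Wiring.linkAmp_add_routeShift hW, Pi.add_apply, hself, paddedψ_add_padZero,
    mul_assoc]
  rfl

theorem exists_idealProj_add_routeShift (hW : (𝒢.wiring P).RoutesDisjoint) (x : 𝒢.Queries)
    (o : 𝒢.IdealOutcome P) (i : Fin r) (c c' : Qudit N k → ZMod d) :
    ∃ K : ℂ, (K ≠ 0 → ∀ j, 𝒢.routeAmp o c' i j ≠ 0) ∧
      ∀ h : ∀ j, Fin (k j) → ZMod d,
        𝒢.idealProj P x o c (c' + (𝒢.wiring P).routeShift i (padZero k h)) =
          K * ∏ j, (rootPow d (∑ s, (𝒢.routeRotation o i j s).2 * h j s) *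
            𝒢.honest.proj j (x i j) (o i j).2 ((𝒢.wiring P).arrivalAt c i j)
              (fun s => (𝒢.wiring P).arrivalAt c' i j s + h j s)) := by
  classical
  let factor (c' : Qudit N k → ZMod d) (i' : Fin r) (j : Fin ℓ) : ℂ :=
    𝒢.routeAmp o c i' j * starRingEnd ℂ (𝒢.routeAmp o c' i' j) *
      𝒢.honest.proj j (x i' j) (o i' j).2 ((𝒢.wiring P).arrivalAt c i' j)
        ((𝒢.wiring P).arrivalAt c' i' j)
  refine ⟨(∏ i' ∈ Finset.univ.erase i, ∏ j, factor c' i' j) *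
    (∏ j, 𝒢.routeAmp o c i j * starRingEnd ℂ (𝒢.routeAmp o c' i j)) *
    if ∀ q, 𝒢.Measured P q ∨ c q = c' q then 1 else 0, fun hK j => ?_, fun h => ?_⟩
  · have hj := Finset.prod_ne_zero_iff.mp (right_ne_zero_of_mul (left_ne_zero_of_mul hK)) j
      (Finset.mem_univ j)
    exact (map_ne_zero _).mp (right_ne_zero_of_mul hj)
  have hother : ∀ i' ∈ Finset.univ.erase i,
      ∏ j, factor (c' + (𝒢.wiring P).routeShift i (padZero k h)) i' j = ∏ j, factor c' i' j := by
    intro i' hi'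
    simp only [factor, Wiring.arrivalAt_add_routeShift_of_ne _ hW _ _ (Finset.ne_of_mem_erase hi'),
      𝒢.routeAmp_add_routeShift_of_ne hW o _ _ (Finset.ne_of_mem_erase hi')]
  have hunmeasured :
      (∀ q, 𝒢.Measured P q ∨ c q = (c' + (𝒢.wiring P).routeShift i (padZero k h)) q) ↔
        ∀ q, 𝒢.Measured P q ∨ c q = c' q :=
    forall_congr' fun q => or_congr_right' fun hq => by
      rw [Pi.add_apply, 𝒢.routeShift_of_not_measured hW i h hq, add_zero]
  rw [idealProj_eq, ← Finset.prod_erase_mul _ _ (Finset.mem_univ i), Finset.prod_congr rfl hother]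
  simp only [hunmeasured, 𝒢.routeAmp_add_routeShift hW, Wiring.arrivalAt_add_routeShift _ hW,
    map_mul, conj_rootPow, neg_neg, Finset.prod_mul_distrib]
  simp only [Pi.add_def]
  ring

theorem wins_of_idealProb_ne_zero [NeZero N] (hW : (𝒢.wiring P).RoutesDisjoint) (x : 𝒢.Queries)
    (o : 𝒢.IdealOutcome P) (ho : 𝒢.idealProb P x o ≠ 0) (i : Fin r)
    (hx : x i ∈ 𝒢.game.dist.support) :
    𝒢.game.Wins (x i) fun j s =>
      (o i j).2 s - cor (𝒢.routeRotation o i j) (x i j s : PauliLabel d (Fin (k j))) := by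
  by_contra hlose
  refine ho (Finset.sum_eq_zero fun c _ => ?_)
  rw [sum_eq_zero_of_sum_translates (fun c' => 𝒢.idealProj P x o c c' * 𝒢.idealState P c')
    fun h : ∀ j, Fin (k j) → ZMod d => (𝒢.wiring P).routeShift i (padZero k h), norm_zero,
    zero_pow two_ne_zero]
  intro c'
  obtain ⟨K₁, hK₁, hproj⟩ := 𝒢.exists_idealProj_add_routeShift hW x o i c c'
  obtain ⟨K₂, hK₂, hstate⟩ := 𝒢.exists_idealState_add_routeShift hW i c'
  simp only [hproj, hstate, mul_mul_mul_comm, ← Finset.mul_sum]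
  by_cases hK : K₁ * K₂ = 0
  · rw [hK, zero_mul]
  obtain ⟨hK₁', hK₂'⟩ := mul_ne_zero_iff.mp hK
  simp only [fun j => 𝒢.arrivalAt_eq_of_ne_zero hW o (hK₂ hK₂') (hK₁ hK₁' j)]
  rw [𝒢.honest.sum_prod_rootPow_mul_proj_eq_zero_of_not_wins 𝒢.perfect hx _ _ hlose, mul_zero]

end CircuitGame

/-! ### Regions of the players -/

namespace GridStar

variable {N ℓ : ℕ} (Γ : GridStar N ℓ)

theorem pt_zero_mem_centralBox (j : Fin ℓ) : (Γ.path j).pt 0 ∈ Γ.centralBox := (Γ.path_start j).1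

theorem pt_last_mem_leafBox (j : Fin ℓ) : (Γ.path j).pt (Fin.last _) ∈ Γ.leafBox j :=
  (Γ.path_end j).1

theorem not_mem_leafBox_of_mem_leafBox {j j' : Fin ℓ} (h : j ≠ j') {v : Grid N}
    (hv : v ∈ Γ.leafBox j) : v ∉ Γ.leafBox j' :=
  Set.disjoint_left.mp (Γ.leaf_disjoint j j' h) hv

theorem not_mem_leafBox_of_mem_path {j j' : Fin ℓ} (h : j ≠ j') {v : Grid N}
    (hv : v ∈ (Γ.path j).verts) : v ∉ Γ.leafBox j' := by
  obtain ⟨t, rfl⟩ := hv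
  by_cases hfirst : t = 0
  · subst hfirst
    exact Set.disjoint_left.mp (Γ.center_disjoint j') (Γ.pt_zero_mem_centralBox j)
  by_cases hlast : t = Fin.last _
  · subst hlast
    exact Γ.not_mem_leafBox_of_mem_leafBox h (Γ.pt_last_mem_leafBox j)
  · exact (Γ.path_inner j t hfirst hlast).2 j'

end GridStar

namespace Wiring

variable {N r ℓ : ℕ} {P : InputPattern N r ℓ} (W : Wiring P)

theorem route_cases (i : Fin r) (j : Fin ℓ) (t : Fin ((W.route i j).len + 1)) :
    (W.route i j).pt t ∈ (P.star i).centralBox ∨ (W.route i j).pt t ∈ ((P.star i).path j).verts ∨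
      (W.route i j).pt t ∈ (P.star i).leafBox j := by
  obtain ⟨B, E, hroute, hB, hE⟩ := W.route_extends i j
  have hmem : (W.route i j).pt t ∈ List.ofFn (W.route i j).pt := (List.mem_ofFn' _ _).mpr ⟨t, rfl⟩
  rw [hroute, List.mem_append, List.mem_append, List.mem_ofFn'] at hmem
  rcases hmem with (hstart | hpath) | hend
  exacts [.inl (hB _ hstart), .inr (.inl hpath), .inr (.inr (hE _ hend))]

theorem route_mem_verts (i : Fin r) (j : Fin ℓ) (t : Fin ((W.route i j).len + 1)) :
    (W.route i j).pt t ∈ (P.star i).verts := by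
  rcases W.route_cases i j t with hcentral | hpath | hleaf
  · exact .inl (.inl hcentral)
  · exact .inr (Set.mem_iUnion.mpr ⟨j, hpath⟩)
  · exact .inl (.inr (Set.mem_iUnion.mpr ⟨j, hleaf⟩))

theorem route_not_mem_leafBox {i : Fin r} {j j' : Fin ℓ} (hj : j ≠ j')
    (t : Fin ((W.route i j).len + 1)) : (W.route i j).pt t ∉ (P.star i).leafBox j' := by
  rcases W.route_cases i j t with hcentral | hpath | hleaf
  · exact Set.disjoint_left.mp ((P.star i).center_disjoint j') hcentral
  · exact (P.star i).not_mem_leafBox_of_mem_path hj hpath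
  · exact (P.star i).not_mem_leafBox_of_mem_leafBox hj hleaf

theorem routesDisjoint
    (hP : ∀ i i', i ≠ i' → Disjoint (P.star i).verts (P.star i').verts) : W.RoutesDisjoint := by
  intro i j i' j' t t' h
  obtain rfl : i = i' := by
    by_contra hne
    exact Set.disjoint_left.mp (hP i i' hne) (W.route_mem_verts i j t)
      (h ▸ W.route_mem_verts i' j' t')
  refine ⟨rfl, ?_⟩
  by_contra hne
  exact Set.disjoint_left.mp (W.route_disjoint i j j' hne) ⟨t, rfl⟩ ⟨t', h.symm⟩

/-- A vertex of a star belongs to player `j` if it lies on the `j`-th route or in the `j`-th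
noncentral box; the remaining ones belong to player `j₀`. -/
def Owns (j₀ : Fin ℓ) (i : Fin r) (j : Fin ℓ) (v : Grid N) : Prop :=
  v ∈ (P.star i).verts ∧ (v ∈ (P.star i).leafBox j ∨ v ∈ (W.route i j).verts ∨
    j = j₀ ∧ ∀ j', v ∉ (P.star i).leafBox j' ∧ v ∉ (W.route i j').verts)

variable {W}

theorem Owns.eq_of_mem_leafBox {j₀ : Fin ℓ} {i : Fin r} {j j' : Fin ℓ} {v : Grid N}
    (h : W.Owns j₀ i j v) (h' : v ∈ (P.star i).leafBox j') : j = j' := by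
  by_contra hne
  obtain ⟨_, hleaf | ⟨t, rfl⟩ | ⟨-, hrest⟩⟩ := h
  · exact (P.star i).not_mem_leafBox_of_mem_leafBox hne hleaf h'
  · exact W.route_not_mem_leafBox hne t h'
  · exact (hrest j').1 h'

theorem Owns.eq {j₀ : Fin ℓ} {i : Fin r} {j j' : Fin ℓ} {v : Grid N}
    (h : W.Owns j₀ i j v) (h' : W.Owns j₀ i j' v) : j = j' := by
  rcases h.2 with hleaf | hroute | ⟨hj, hrest⟩
  · exact (h'.eq_of_mem_leafBox hleaf).symm
  all_goals rcases h'.2 with hleaf' | hroute' | ⟨hj', hrest'⟩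
  · exact h.eq_of_mem_leafBox hleaf'
  · by_contra hne
    exact Set.disjoint_left.mp (W.route_disjoint i j j' hne) hroute hroute'
  · exact absurd hroute (hrest' j).2
  · exact h.eq_of_mem_leafBox hleaf'
  · exact absurd hroute' (hrest j').2
  · exact hj.trans hj'.symm

variable (W)

open Classical in
/-- The partition of the stars according to `Owns`. -/
noncomputable def ownedRegions [NeZero N] (j₀ : Fin ℓ) : CircuitGame.Regions W where
  region i j := Finset.univ.filter fun v => W.Owns j₀ i j v
  disjoint i j j' hj := by
    rw [Finset.disjoint_left]
    intro v h h'
    exact hj ((Finset.mem_filter.mp h).2.eq (Finset.mem_filter.mp h').2)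
  cover i v := by
    simp only [Finset.mem_filter, Finset.mem_univ, true_and]
    refine ⟨fun h => ?_, fun ⟨j, h⟩ => h.1⟩
    by_cases howner : ∃ j, v ∈ (P.star i).leafBox j ∨ v ∈ (W.route i j).verts
    · obtain ⟨j, hj⟩ := howner
      exact ⟨j, h, hj.imp_right .inl⟩
    · push Not at howner
      exact ⟨j₀, h, .inr (.inr ⟨rfl, howner⟩)⟩
  route_mem i j t := by
    simp only [Finset.mem_filter, Finset.mem_univ, true_and]
    exact ⟨W.route_mem_verts i j t, .inr (.inl ⟨t, rfl⟩)⟩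

theorem mem_ownedRegions [NeZero N] {j₀ : Fin ℓ} {i : Fin r} {j : Fin ℓ} {v : Grid N} :
    v ∈ (W.ownedRegions j₀).region i j ↔ W.Owns j₀ i j v := by
  classical
  simp [ownedRegions]

end Wiring

theorem PatternSampler.disjoint_verts {N r ℓ L : ℕ} (D : PatternSampler N r ℓ L)
    {P : InputPattern N r ℓ} (hP : P ∈ D.dist.support) (i i' : Fin r) (hi : i ≠ i') :
    Disjoint (P.star i).verts (P.star i').verts := by
  rw [PatternSampler.dist, PMF.support_map] at hP
  obtain ⟨ω, -, rfl⟩ := hP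
  exact (D.square_disjoint i i' hi).mono (D.stars_subset i _ _) (D.stars_subset i' _ _)

theorem CircuitSpec.Causal.eq_of_mem_lightcone {N r ℓ : ℕ} {P : InputPattern N r ℓ}
    {spec : CircuitSpec N} {V : Set (Fin r)} (h : spec.Causal P V) {W : Wiring P} {j₀ : Fin ℓ}
    {i i' : Fin r} (hi : i ∈ V) (hi' : i' ∈ V) {j j' : Fin ℓ} {v : Grid N}
    (hv : W.Owns j₀ i j v) (hl : v ∈ spec.lightcone (P.loc i' j')) : i' = i ∧ j' = j := by
  obtain ⟨⟨hown, hother, -⟩, -⟩ := h i hi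
  obtain rfl : i' = i := by
    by_contra hne
    exact (Set.eq_empty_iff_forall_notMem.mp (hother i' hi' hne j')) v ⟨hl, hv.1⟩
  exact ⟨rfl, (hv.eq_of_mem_leafBox (hown j' ⟨hl, hv.1⟩)).symm⟩

/-! ### Averaging over queries -/

theorem pmfPi_apply {r : ℕ} {X : Fin r → Type} [∀ i, Fintype (X i)] (π : ∀ i, PMF (X i))
    (x : ∀ i, X i) : pmfPi π x = ∏ i, π i (x i) := rfl

theorem mem_support_pmfPi {r : ℕ} {X : Fin r → Type} [∀ i, Fintype (X i)] {π : ∀ i, PMF (X i)}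
    {x : ∀ i, X i} : x ∈ (pmfPi π).support ↔ ∀ i, x i ∈ (π i).support := by
  simp [PMF.mem_support_iff, pmfPi_apply, Finset.prod_eq_zero_iff]

theorem pmfPi_map {r : ℕ} {X Y : Fin r → Type} [∀ i, Fintype (X i)] [∀ i, Fintype (Y i)]
    (π : ∀ i, PMF (X i)) (f : ∀ i, X i → Y i) :
    pmfPi (fun i => (π i).map (f i)) = (pmfPi π).map fun x i => f i (x i) := by
  classical
  ext y
  simp only [pmfPi_apply, PMF.map_apply, tsum_fintype]
  rw [Finset.prod_univ_sum, Fintype.piFinset_univ]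
  refine Finset.sum_congr rfl fun x _ => ?_
  by_cases h : y = fun i => f i (x i)
  · subst h
    simp
  · rw [if_neg h]
    obtain ⟨i, hi⟩ := Function.ne_iff.mp h
    exact Finset.prod_eq_zero (Finset.mem_univ i) (if_neg hi)

theorem sum_toReal_pmf_map_mul {X Y : Type*} [Fintype X] [Fintype Y] (μ : PMF X) (f : X → Y)
    (F : Y → ℝ) : ∑ y, (μ.map f y).toReal * F y = ∑ x, (μ x).toReal * F (f x) := by
  classical
  have hmap : ∀ y, (μ.map f y).toReal = ∑ x, if y = f x then (μ x).toReal else 0 := by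
    intro y
    simp only [PMF.map_apply, tsum_fintype]
    rw [ENNReal.toReal_sum fun x _ => by split_ifs <;> simp [μ.apply_ne_top x]]
    exact Finset.sum_congr rfl fun x _ => by split_ifs <;> rfl
  simp only [hmap, Finset.sum_mul, ite_mul, zero_mul]
  rw [Finset.sum_comm]
  simp only [Finset.sum_ite_eq', Finset.mem_univ, if_true]

theorem sum_toReal_pmf {X : Type*} [Fintype X] (μ : PMF X) : ∑ x, (μ x).toReal = 1 := by
  rw [← ENNReal.toReal_sum fun x _ => μ.apply_ne_top x, ← tsum_fintype (L := .unconditional _),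
    μ.tsum_coe, ENNReal.toReal_one]

theorem exists_mem_support_sum_toReal_mul_le {X : Type*} [Fintype X] (μ : PMF X) (F : X → ℝ) :
    ∃ z ∈ μ.support, ∑ x, (μ x).toReal * F x ≤ F z := by
  by_contra! hlt
  obtain ⟨z, hz⟩ := μ.support_nonempty
  have hpos : ∀ z ∈ μ.support, 0 < (μ z).toReal := fun z hz =>
    ENNReal.toReal_pos ((μ.mem_support_iff z).mp hz) (μ.apply_ne_top z)
  refine lt_irrefl (∑ x, (μ x).toReal * F x) ?_
  calc ∑ x, (μ x).toReal * F x
      < ∑ y, (μ y).toReal * ∑ x, (μ x).toReal * F x := by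
        refine Finset.sum_lt_sum (fun y _ => ?_)
          ⟨z, Finset.mem_univ z, mul_lt_mul_of_pos_left (hlt z hz) (hpos z hz)⟩
        by_cases hy : y ∈ μ.support
        · exact (mul_lt_mul_of_pos_left (hlt y hy) (hpos y hy)).le
        · simp [(μ.apply_eq_zero_iff y).mpr hy]
    _ = ∑ x, (μ x).toReal * F x := by rw [← Finset.sum_mul, sum_toReal_pmf, one_mul]

section PiecewiseAveraging

variable {r : ℕ} {X : Fin r → Type} [∀ i, Fintype (X i)]

theorem pmfPi_piecewise_mul_pmfPi_piecewise (π : ∀ i, PMF (X i)) (V : Finset (Fin r))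
    (x z : ∀ i, X i) :
    pmfPi π (V.piecewise x z) * pmfPi π (V.piecewise z x) = pmfPi π x * pmfPi π z := by
  simp only [pmfPi_apply, ← Finset.prod_mul_distrib]
  refine Finset.prod_congr rfl fun i _ => ?_
  by_cases hi : i ∈ V
  · simp only [Finset.piecewise_eq_of_mem _ _ _ hi]
  · simp only [Finset.piecewise_eq_of_notMem _ _ _ hi, mul_comm]

theorem sum_toReal_pmfPi_mul_sum_piecewise (π : ∀ i, PMF (X i)) (V : Finset (Fin r))
    (w : (∀ i, X i) → ℝ) :
    ∑ z, (pmfPi π z).toReal * ∑ x, (pmfPi π x).toReal * w (V.piecewise x z) =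
      ∑ x, (pmfPi π x).toReal * w x := by
  let exchange (a : (∀ i, X i) × ∀ i, X i) := (V.piecewise a.1 a.2, V.piecewise a.2 a.1)
  have hinv : Function.Involutive exchange := fun a => by
    refine Prod.ext (funext fun i => ?_) (funext fun i => ?_) <;>
      by_cases hi : i ∈ V <;> simp [exchange, hi]
  calc ∑ z, (pmfPi π z).toReal * ∑ x, (pmfPi π x).toReal * w (V.piecewise x z)
      = ∑ a : (∀ i, X i) × ∀ i, X i,
          (pmfPi π (exchange a).1 * pmfPi π (exchange a).2).toReal * w (exchange a).1 := by
        simp only [exchange, pmfPi_piecewise_mul_pmfPi_piecewise, Fintype.sum_prod_type_right,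
          ENNReal.toReal_mul, Finset.mul_sum, mul_assoc, mul_left_comm]
    _ = ∑ a : (∀ i, X i) × ∀ i, X i, (pmfPi π a.1 * pmfPi π a.2).toReal * w a.1 :=
        Equiv.sum_comp hinv.toPerm fun a => (pmfPi π a.1 * pmfPi π a.2).toReal * w a.1
    _ = ∑ x, (pmfPi π x).toReal * w x := by
        simp only [Fintype.sum_prod_type, ENNReal.toReal_mul, ← Finset.sum_mul, ← Finset.mul_sum,
          sum_toReal_pmf, mul_one]

theorem exists_sum_toReal_pmfPi_le_piecewise (π : ∀ i, PMF (X i)) (V : Finset (Fin r))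
    (w : (∀ i, X i) → ℝ) :
    ∃ z ∈ (pmfPi π).support, ∑ x, (pmfPi π x).toReal * w x ≤
      ∑ x, (pmfPi π x).toReal * w (V.piecewise x z) := by
  rw [← sum_toReal_pmfPi_mul_sum_piecewise π V w]
  exact exists_mem_support_sum_toReal_mul_le _ _

end PiecewiseAveraging

/-! ### Simulation of the circuit by a strategy -/

theorem cor_extendLabel_right {d : ℕ} {κ κ' : Type} [Fintype κ] [Fintype κ'] (e : κ ↪ κ')
    (r : PauliLabel d κ') (q : PauliLabel d κ) : cor r (extendLabel e q) = cor (r ∘ e) q := by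
  classical
  unfold cor
  rw [← Finset.sum_subset (Finset.subset_univ (Finset.univ.map e)), Finset.sum_map]
  · simp only [extendLabel_apply, Function.comp_apply]
  · intro i _ hi
    have : ¬ ∃ a, e a = i := by simpa using hi
    simp [extendLabel_apply_of_not e _ i this]

namespace StabilizerGame

variable {ℓ d : ℕ} [NeZero d] {κ κ' : Fin ℓ → Type} [∀ j, Fintype (κ j)] [∀ j, DecidableEq (κ j)]
  {m : Fin ℓ → ℕ}

theorem unstretchQuery_stretchQuery (G : StabilizerGame ℓ d κ m) (e : ∀ j, κ j ↪ κ' j)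
    (x : G.Query) : G.unstretchQuery e (G.stretchQuery e x) = x := by
  funext j s
  exact Subtype.ext (extendLabel_comp _ _)

theorem unstretchQuery_congr (G : StabilizerGame ℓ d κ m) (e : ∀ j, κ j ↪ κ' j)
    {x x' : ∀ j, Fin (m j) →
      ((G.labels j).map (extendLabel (e j)) : Finset (PauliLabel d (κ' j)))} {j : Fin ℓ}
    (h : x j = x' j) : G.unstretchQuery e x j = G.unstretchQuery e x' j := by
  funext s
  refine Subtype.ext ?_
  change (x j s : PauliLabel d (κ' j)) ∘ e j = (x' j s : PauliLabel d (κ' j)) ∘ e j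
  rw [h]

variable [∀ j, Fintype (κ' j)] [∀ j, DecidableEq (κ' j)]

theorem rotated_stretch_wins_iff (G : StabilizerGame ℓ d κ m) (e : ∀ j, κ j ↪ κ' j)
    (x : G.Query) (a : ∀ j, RotatedAnswer d κ' m j) :
    (G.stretch e).rotated.wins (G.stretchQuery e x) a ↔
      G.Wins x fun j s => (a j).1 s - cor ((a j).2 ∘ e j) (x j s : PauliLabel d (κ j)) := by
  simp only [rotated, Wins, stretch, unstretchQuery_stretchQuery, stretchQuery,
    cor_extendLabel_right]

end StabilizerGame

namespace CircuitGame

variable {ℓ d : ℕ} [NeZero d] {k m : Fin ℓ → ℕ} {N r L : ℕ} {A : Type}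
  (𝒢 : CircuitGame ℓ d k m N r L A) {P : InputPattern N r ℓ}

theorem encode_congr {x x' : 𝒢.Queries} {v : Grid N}
    (h : ∀ i j, P.loc i j = v → x i j = x' i j) : 𝒢.encode P x v = 𝒢.encode P x' v := by
  unfold encode inputSymbol
  congr 1
  dsimp only
  split_ifs with hroute hlt
  · rfl
  · rfl
  · set s := hroute.choose
    congr 1
    refine h _ _ ?_
    calc P.loc s.1 s.2.1 = ((𝒢.wiring P).route s.1 s.2.1).pt (Fin.last _) :=
          ((𝒢.wiring P).route_end _ _).symm
      _ = ((𝒢.wiring P).route s.1 s.2.1).pt s.2.2 := by rw [Fin.eq_last_of_not_lt hlt]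
      _ = v := hroute.choose_spec
  · rfl

theorem decode_congr (Γ : Regions (𝒢.wiring P)) (p : Fin r × Fin ℓ) {y y' : Grid N → A}
    (h : ∀ v ∈ Γ.region p.1 p.2, y v = y' v) : 𝒢.decode Γ y p = 𝒢.decode Γ y' p := by
  unfold decode
  refine Prod.ext ?_ (funext fun q => ?_)
  · simp only [h _ (Γ.loc_mem p.1 p.2)]
  · simp only [h _ (Γ.route_mem p.1 p.2 _), h _ q.1.2]

/-- The query of the stabilizer game that underlies the questions of the `i`-th instance of the
repeated rotated stretched game. -/
noncomputable def instanceQuery (Γ : Regions (𝒢.wiring P)) (X : ∀ p, 𝒢.PlayerQuestion Γ p)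
    (i : Fin r) : 𝒢.game.Query :=
  𝒢.game.unstretchQuery (fun j => Γ.designated k i j) fun j => X (i, j)

theorem instanceQuery_playerQuestions (Γ : Regions (𝒢.wiring P)) (x : 𝒢.Queries) :
    𝒢.instanceQuery Γ (𝒢.playerQuestions Γ x) = x := by
  funext i
  exact 𝒢.game.unstretchQuery_stretchQuery _ _

theorem instanceQuery_congr (Γ : Regions (𝒢.wiring P)) {X X' : ∀ p, 𝒢.PlayerQuestion Γ p}
    {i : Fin r} {j : Fin ℓ} (h : X (i, j) = X' (i, j)) :
    𝒢.instanceQuery Γ X i j = 𝒢.instanceQuery Γ X' i j :=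
  𝒢.game.unstretchQuery_congr _ h

theorem repeated_dist (Γ : Regions (𝒢.wiring P)) :
    (NonlocalGame.repeated (𝒢.instanceGame Γ)).dist =
      (pmfPi fun _ : Fin r => 𝒢.game.dist).map (𝒢.playerQuestions Γ) :=
  (congrArg (PMF.map _) (pmfPi_map (fun _ => 𝒢.game.dist) fun i =>
    𝒢.game.stretchQuery fun j => Γ.designated k i j)).trans (PMF.map_comp _ _ _)

theorem dist_apply (P : InputPattern N r ℓ) (x : 𝒢.Queries) :
    𝒢.dist (P, x) = 𝒢.sampler.dist P * pmfPi (fun _ : Fin r => 𝒢.game.dist) x := by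
  classical
  unfold dist
  rw [PMF.bind_apply, tsum_eq_single P]
  · rw [PMF.map_apply]
    congr 1
    exact (tsum_eq_single x fun x' hx' => if_neg fun h => hx' (Prod.ext_iff.mp h).2.symm).trans
      (if_pos rfl)
  · intro P' hP'
    rw [PMF.map_apply]
    refine mul_eq_zero_of_right _ (ENNReal.tsum_eq_zero.mpr fun x' => if_neg fun h => ?_)
    exact hP' (Prod.ext_iff.mp h).1.symm

theorem mem_support_of_mem_support_dist {x : 𝒢.Queries} (h : (P, x) ∈ 𝒢.dist.support) (i : Fin r) :
    x i ∈ 𝒢.game.dist.support := by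
  rw [PMF.mem_support_iff, 𝒢.dist_apply] at h
  exact mem_support_pmfPi.mp ((PMF.mem_support_iff _ _).mpr (right_ne_zero_of_mul h)) i

theorem condWinProb_eq [NeZero N] [Fintype A] [DecidableEq A] (C : Circuit N A)
    (hP : P ∈ 𝒢.sampler.dist.support) :
    𝒢.condWinProb C P =
      ∑ x, (pmfPi (fun _ : Fin r => 𝒢.game.dist) x).toReal * 𝒢.winProbOn C (P, x) := by
  unfold condWinProb
  have hP₀ : (𝒢.sampler.dist P).toReal ≠ 0 :=
    ENNReal.toReal_ne_zero.mpr ⟨(PMF.mem_support_iff _ _).mp hP, PMF.apply_ne_top _ _⟩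
  simp only [dist_apply, ENNReal.toReal_mul, ← Finset.mul_sum, mul_assoc, sum_toReal_pmf, mul_one]
  rw [mul_div_cancel_left₀ _ hP₀]

theorem decode_rotation_designated (Γ : Regions (𝒢.wiring P)) (o : 𝒢.IdealOutcome P) (i : Fin r)
    (j : Fin ℓ) {y : Grid N → A}
    (hy : ∀ t, y (((𝒢.wiring P).route i j).pt t.castSucc) = 𝒢.encTel ((o i j).1 t)) :
    (𝒢.decode Γ y (i, j)).2 ∘ Γ.designated k i j = 𝒢.routeRotation o i j := by
  have hdec : ∀ t, 𝒢.decTel (y (((𝒢.wiring P).route i j).pt t.castSucc)) = (o i j).1 t := by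
    intro t
    rw [hy]
    exact Function.leftInverse_invFun 𝒢.encTel.injective _
  funext s
  change (if P.loc i j = P.loc i j then _ else _) = _
  simp only [if_true, hdec]
  rfl

theorem decode_answer (Γ : Regions (𝒢.wiring P)) {i : Fin r} {j : Fin ℓ} {y : Grid N → A}
    {a : Fin (m j) → ZMod d} (hy : y (P.loc i j) = 𝒢.encAns j a) :
    (𝒢.decode Γ y (i, j)).1 = a := by
  change Function.invFun (𝒢.encAns j) (y (P.loc i j)) = a
  rw [hy]
  exact Function.leftInverse_invFun (𝒢.encAns j).injective a

theorem instance_wins_of_relation [NeZero N] (hW : (𝒢.wiring P).RoutesDisjoint)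
    (Γ : Regions (𝒢.wiring P)) {x : 𝒢.Queries} {y : Grid N → A} (h : ((P, x), y) ∈ 𝒢.relation)
    (i : Fin r) :
    (𝒢.instanceGame Γ i).wins (fun j => 𝒢.playerQuestions Γ x (i, j))
      fun j => 𝒢.decode Γ y (i, j) := by
  obtain ⟨hx, o, ho, hy⟩ := h
  refine (𝒢.game.rotated_stretch_wins_iff _ (x i) _).mpr ?_
  simp only [𝒢.decode_rotation_designated Γ o i _ (hy i _).1, 𝒢.decode_answer Γ (hy i _).2]
  exact 𝒢.wins_of_idealProb_ne_zero hW x o ho i (𝒢.mem_support_of_mem_support_dist hx i)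

/-- The decoding of an output of the circuit for the repeated game in which only the instances in
`V` are simulated: the players of the other instances answer `0`. -/
noncomputable def decodeOn (Γ : Regions (𝒢.wiring P)) (V : Finset (Fin r)) (y : Grid N → A) :
    ∀ p, 𝒢.PlayerAnswer Γ p :=
  fun p => if p.1 ∈ V then 𝒢.decode Γ y p else 0

theorem decodeOn_of_mem (Γ : Regions (𝒢.wiring P)) {V : Finset (Fin r)} (y : Grid N → A)
    {i : Fin r} (hi : i ∈ V) (j : Fin ℓ) : 𝒢.decodeOn Γ V y (i, j) = 𝒢.decode Γ y (i, j) :=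
  if_pos hi

theorem decodeOn_congr (Γ : Regions (𝒢.wiring P)) {V : Finset (Fin r)} (p : Fin r × Fin ℓ)
    {y y' : Grid N → A} (h : p.1 ∈ V → ∀ v ∈ Γ.region p.1 p.2, y v = y' v) :
    𝒢.decodeOn Γ V y p = 𝒢.decodeOn Γ V y' p := by
  unfold decodeOn
  split_ifs with hp
  exacts [𝒢.decode_congr Γ p (h hp), rfl]

open Classical in
theorem card_le_card_wins_decodeOn [NeZero N] (hW : (𝒢.wiring P).RoutesDisjoint)
    {Γ : Regions (𝒢.wiring P)} {V : Finset (Fin r)} {x xbar : 𝒢.Queries} {y : Grid N → A}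
    (h : ((P, V.piecewise x xbar), y) ∈ 𝒢.relation) :
    V.card ≤ (Finset.univ.filter fun i => (𝒢.instanceGame Γ i).wins
      (fun j => 𝒢.playerQuestions Γ x (i, j)) fun j => 𝒢.decodeOn Γ V y (i, j)).card := by
  refine Finset.card_le_card fun i hi => Finset.mem_filter.mpr ⟨Finset.mem_univ i, ?_⟩
  have hwins := 𝒢.instance_wins_of_relation hW Γ h i
  simpa only [playerQuestions, Finset.piecewise_eq_of_mem _ _ _ hi, 𝒢.decodeOn_of_mem Γ y hi]
    using hwins

/-- No vertex in the region of a player of an instance in `V` has in its backward lightcone the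
input location of another player of the instances in `V`. -/
def Regions.IsolatedOn [Fintype A] [DecidableEq A] {W : Wiring P} (Γ : Regions W)
    (C : Circuit N A) (V : Finset (Fin r)) : Prop :=
  ∀ i ∈ V, ∀ j, ∀ v ∈ Γ.region i j, ∀ i' ∈ V, ∀ j',
    P.loc i' j' ∈ C.backwardLightcone (.output v) → i' = i ∧ j' = j

theorem isolatedOn_ownedRegions [NeZero N] [Fintype A] [DecidableEq A] (W : Wiring P)
    (C : Circuit N A) {badIn badOut : Set (Grid N)} {V : Finset (Fin r)}
    (h : CircuitSpec.Causal ⟨C.forwardLightcone, badIn, badOut⟩ P V) (j₀ : Fin ℓ) :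
    (W.ownedRegions j₀).IsolatedOn C V :=
  fun _ hi _ _ hv _ hi' _ hl => h.eq_of_mem_lightcone hi hi' (W.mem_ownedRegions.mp hv) hl

section Simulation

variable [NeZero N] [Fintype A] [DecidableEq A] {Γ : Regions (𝒢.wiring P)} {V : Finset (Fin r)}

open Classical in
theorem exists_strategy_prob_eq_sum_decodeOn (C : Circuit N A) (hΓ : Γ.IsolatedOn C V)
    (xbar : 𝒢.Queries) :
    ∃ S : Strategy (𝒢.PlayerQuestion Γ) (𝒢.PlayerAnswer Γ), ∀ x a,
      S.prob (𝒢.playerQuestions Γ x) a =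
        ∑ y with 𝒢.decodeOn Γ V y = a, C.outProb (𝒢.encode P (V.piecewise x xbar)) y := by
  have : Nonempty A := ⟨𝒢.encIn .idle⟩
  let input (X : ∀ p, 𝒢.PlayerQuestion Γ p) : Grid N → A :=
    𝒢.encode P (V.piecewise (𝒢.instanceQuery Γ X) xbar)
  have hinput : ∀ u X X', (∀ q ∈ {q : Fin r × Fin ℓ | q.1 ∈ V ∧ P.loc q.1 q.2 = u}, X q = X' q) →
      input X u = input X' u := by
    refine fun u X X' h => 𝒢.encode_congr fun i j hu => ?_
    by_cases hi : i ∈ V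
    · simp only [Finset.piecewise_eq_of_mem _ _ _ hi]
      exact 𝒢.instanceQuery_congr Γ (h (i, j) ⟨hi, hu⟩)
    · simp only [Finset.piecewise_eq_of_notMem _ _ _ hi]
  obtain ⟨S, hS⟩ := C.exists_strategy input _ hinput (𝒢.playerQuestions Γ xbar)
    (fun q => {v | q.1 ∈ V ∧ v ∈ Γ.region q.1 q.2}) (fun q y => 𝒢.decodeOn Γ V y q)
    (fun q y y' h => 𝒢.decodeOn_congr Γ q fun hq v hv => h v ⟨hq, hv⟩) <| by
      rintro q v ⟨hq, hv⟩ u hu q' ⟨hq', rfl⟩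
      exact Prod.ext_iff.mpr (hΓ q.1 hq q.2 v hv q'.1 hq' q'.2 hu)
  refine ⟨S, fun x a => ?_⟩
  simp only [hS, input, 𝒢.instanceQuery_playerQuestions, funext_iff]

theorem exists_strategy_sum_prob_eq (C : Circuit N A) (hΓ : Γ.IsolatedOn C V) (xbar : 𝒢.Queries) :
    ∃ S : Strategy (𝒢.PlayerQuestion Γ) (𝒢.PlayerAnswer Γ),
      ∀ (x : 𝒢.Queries) (E : (∀ q, 𝒢.PlayerAnswer Γ q) → Prop) [DecidablePred E],
        ∑ a with E a, S.prob (𝒢.playerQuestions Γ x) a =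
          ∑ y with E (𝒢.decodeOn Γ V y), C.outProb (𝒢.encode P (V.piecewise x xbar)) y := by
  classical
  obtain ⟨S, hS⟩ := 𝒢.exists_strategy_prob_eq_sum_decodeOn C hΓ xbar
  refine ⟨S, fun x E _ => ?_⟩
  simp only [hS]
  exact (Finset.sum_fiberwise_eq_sum_filter _ _ _ _).trans (by simp)

open Classical in
theorem sum_winProbOn_le_probWinsAtLeast (hW : (𝒢.wiring P).RoutesDisjoint) (C : Circuit N A)
    (xbar : 𝒢.Queries) {t : ℝ} (ht : t ≤ V.card)
    (S : Strategy (𝒢.PlayerQuestion Γ) (𝒢.PlayerAnswer Γ))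
    (hS : ∀ (x : 𝒢.Queries) (E : (∀ q, 𝒢.PlayerAnswer Γ q) → Prop) [DecidablePred E],
      ∑ a with E a, S.prob (𝒢.playerQuestions Γ x) a =
        ∑ y with E (𝒢.decodeOn Γ V y), C.outProb (𝒢.encode P (V.piecewise x xbar)) y) :
    ∑ x, (pmfPi (fun _ : Fin r => 𝒢.game.dist) x).toReal *
        𝒢.winProbOn C (P, V.piecewise x xbar) ≤
      S.probWinsAtLeast (𝒢.instanceGame Γ) t := by
  have : Nonempty A := ⟨𝒢.encIn .idle⟩
  unfold Strategy.probWinsAtLeast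
  rw [𝒢.repeated_dist, sum_toReal_pmf_map_mul]
  refine Finset.sum_le_sum fun x _ => mul_le_mul_of_nonneg_left ?_ ENNReal.toReal_nonneg
  rw [hS]
  exact Finset.sum_le_sum_of_subset_of_nonneg (Finset.monotone_filter_right _ fun y _ hy =>
    ht.trans (Nat.cast_le.mpr (𝒢.card_le_card_wins_decodeOn hW hy)))
    fun y _ _ => C.outProb_nonneg _ y

end Simulation

end CircuitGame

open Classical in
theorem mainTheorem3 {ℓ d N r L K D : ℕ} [NeZero d] [NeZero N] {k m : Fin ℓ → ℕ}
    {A : Type} [Fintype A] [DecidableEq A]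
    (hr : 1 ≤ r) (hrN : r ≤ N)
    (𝒢 : CircuitGame ℓ d k m N r L A)
    (C : Circuit N A) (hfan : C.FanInLE K) (hdepth : C.depth = D)
    (P : InputPattern N r ℓ) (hP : P ∈ 𝒢.sampler.dist.support)
    (p : ℝ) (hp : 𝒢.condWinProb C P = p)
    (badIn : Set (Grid N)) (spec : CircuitSpec N)
    (hspec : spec = ⟨C.forwardLightcone, badIn, ∅⟩)
    (V : Finset (Fin r)) (hV : V = Finset.univ.filter fun i => spec.Valid P i)
    (hcausal : spec.Causal P V)
    (δ : ℝ) (hδ0 : 0 ≤ δ) (hδ1 : δ ≤ 1) (hfrac : (1 - δ) * r ≤ V.card) :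
    ∃ Γ : CircuitGame.Regions (𝒢.wiring P),
      (∀ i ∈ V, ∀ j, ∀ v ∈ Γ.region i j, ∀ i' ∈ V, ∀ j',
        P.loc i' j' ∈ C.backwardLightcone (.output v) → i' = i ∧ j' = j) ∧
      ∃ (S : Strategy (𝒢.PlayerQuestion Γ) (𝒢.PlayerAnswer Γ)) (xbar : 𝒢.Queries),
        (∀ i, xbar i ∈ 𝒢.game.dist.support) ∧
        p ≤ S.probWinsAtLeast (𝒢.instanceGame Γ) ((1 - δ) * r) ∧
        ∀ (x : 𝒢.Queries) (α : ∀ q, 𝒢.PlayerAnswer Γ q),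
          (∑ a with ∀ i ∈ V, ∀ j, a (i, j) = α (i, j), S.prob (𝒢.playerQuestions Γ x) a) =
            ∑ y : Grid N → A with ∀ i ∈ V, ∀ j, 𝒢.decode Γ y (i, j) = α (i, j),
              C.outProb (𝒢.encode P fun i => if i ∈ V then x i else xbar i) y := by
  subst hspec
  have hW : (𝒢.wiring P).RoutesDisjoint :=
    (𝒢.wiring P).routesDisjoint fun i i' => 𝒢.sampler.disjoint_verts hP i i'
  let Γ := (𝒢.wiring P).ownedRegions ⟨0, 𝒢.sampler.ell_pos⟩
  have hΓ : Γ.IsolatedOn C V := CircuitGame.isolatedOn_ownedRegions _ C hcausal _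
  obtain ⟨xbar, hxbar, hge⟩ := exists_sum_toReal_pmfPi_le_piecewise (fun _ => 𝒢.game.dist) V
    fun x => 𝒢.winProbOn C (P, x)
  rw [← 𝒢.condWinProb_eq C hP, hp] at hge
  obtain ⟨S, hS⟩ := 𝒢.exists_strategy_sum_prob_eq C hΓ xbar
  refine ⟨Γ, hΓ, S, xbar, mem_support_pmfPi.mp hxbar,
    hge.trans (𝒢.sum_winProbOn_le_probWinsAtLeast hW C xbar hfrac S hS), fun x α => ?_⟩
  rw [hS x fun a => ∀ i ∈ V, ∀ j, a (i, j) = α (i, j)]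
  refine Finset.sum_congr (Finset.filter_congr fun y _ => ?_) fun _ _ => rfl
  exact forall₂_congr fun i hi => forall_congr' fun j => by rw [𝒢.decodeOn_of_mem Γ y hi]
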